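/- **Conventions.** Graphs are in the sense of Serre: each undirected edge underlies two opposite directed edges $e,\overline e$, with $e$ running from $i(e)$ to $t(e)$; loops and multiple edges are allowed. A *generating set* $A$ of a group $G$ is a finite set of letters, each representing an element of $G$ (different letters may represent the same element), that generates $G$, is closed under inversion (with an involution $a\mapsto a^{-1}$ of the letters), and has no letter representing the identity. In the Cayley graph $\Gamma_A(G)$ the directed edge $e_{g,a}$ runs from $g$ to $ga$, has label $a$, and has opposite edge $e_{ga,a^{-1}}$. The label of a path $p$ is denoted $\mathrm{label}(p)\in A^*$. A *flow function* with bound $K\ge 0$ for $G$ over $A$, with respect to a spanning tree $T$ of $\Gamma_A(G)$, is a map $\Phi$ from directed edges of $\Gamma_A(G)$ to directed paths such that (F1) $\Phi(e)$ has the same initial and terminal vertices as $e$ and length at most $K$; (F2) $\Phi(e)=e$ for every directed edge $e$ whose underlying undirected edge lies in $T$; (F3) there is no infinite sequence $e_1,e_2,\dots$ of directed edges not in $T$ with each $e_{i+1}$ on the path $\Phi(e_i)$. Let $\mathcal N_T\subseteq A^*$ be the set of labels of the non-backtracking paths in $T$ starting at $1$, and let $\mathrm{graph}(\Phi)=\{(y,a,\mathrm{label}(\Phi(e_{y,a})))\mid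 y\in\mathcal N_T,\ a\in A\}\subseteq (A^*)^3$, where the $y$ in $e_{y,a}$ stands for the group element it represents. $G$ is *stackable* if it has a flow function with some bound over some generating set, and *autostackable* if moreover $\Phi$ can be chosen so that $\mathrm{graph}(\Phi)$ is synchronously regular (the set of words over $(A\cup\{\$\})^3$ obtained by padding the triples with $\$$ is accepted by a finite state automaton). $G$ is *stackable respecting* a subgroup $H$ (respectively, *autostackable respecting* $H$) if it has such a flow function $\Phi$ (respectively, one with $\mathrm{graph}(\Phi)$ synchronously regular), with spanning tree $T$ over $A$, satisfying: - *Subgroup closure.* There is a finite inverse-closed set $B\subseteq A$ generating $H$ such that $T$ contains a spanning tree $T_H$ of the subgraph $\Gamma_B(H)$ of $\Gamma_A(G)$, and $\mathrm{label}(\Phi(e_{h,b}))\in B^*$ for all $h\in H$, $b\in B$. - *$H$-translation invariance.* There is a subtree $T'$ of $T$ containing the vertex $1$ such that $T=T_H\cup\bigcup_{h\in H}hT'$; the trees $hT'$, $h\in H$, are pairwise disjoint; $hT'\cap T_H$ is the single vertex $h$ for every $h\in H$; and $\mathrm{label}(\Phi(e_{g,a}))=\mathrm{label}(\Phi(e_{hg,a}))$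 for every directed edge $e_{g,a}$ not in $\Gamma_B(H)$ and every $h\in H$. A *graph of groups* $\mathcal G$ over a connected graph $\Lambda$ consists of a group $G_v$ for each vertex $v$, a group $G_e=G_{\overline e}$ for each edge $e$, and an injective homomorphism $h_e\colon G_e\to G_{t(e)}$ for each directed edge $e$. For a spanning tree $T_\Lambda$ of $\Lambda$, the *fundamental group* $\pi_1(\mathcal G)=\pi_1(\mathcal G,T_\Lambda)$ is the quotient of the free product of all the groups $G_v$ and the free group on the set of directed edges not in $T_\Lambda$ by the relations $\overline e=e^{-1}$ for $e$ not in $T_\Lambda$; $h_e(g)=h_{\overline e}(g)$ for $e$ in $T_\Lambda$ and $g\in G_e$; and $e\,h_e(g)\,e^{-1}=h_{\overline e}(g)$ for $e$ not in $T_\Lambda$ and $g\in G_e$. **Theorem.** Let $\mathcal G$ be a graph of groups over a finite connected graph $\Lambda$ with at least one edge, and let $T_\Lambda$ be a spanning tree of $\Lambda$. If for each directed edge $e$ of $\Lambda$ the vertex group $G_{t(e)}$ is autostackable [respectively, stackable] respecting $h_e(G_e)$, then $\pi_1(\mathcal G,T_\Lambda)$ is autostackable [respectively, stackable]. -/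

import Mathlib

/-! Graphs in the sense of Serre, graphs of groups and their fundamental groups, Cayley graphs,
flow functions, (auto)stackable groups, and (auto)stackability respecting a subgroup. -/

namespace GoG

/-- A graph with vertex set `V` and set of directed edges `D`. Every directed edge `e` has an
opposite directed edge `bar e`; an undirected edge is a pair `{e, bar e}`. Loops and multiple
edges are allowed. -/
structure DirGraph (V D : Type*) where
  src : D → V
  tgt : D → V
  bar : D → D
  bar_bar : ∀ e, bar (bar e) = e
  bar_ne : ∀ e, bar e ≠ e
  src_bar : ∀ e, src (bar e) = tgt e

namespace DirGraph

variable {V D : Type*} (Γ : DirGraph V D)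

/-- The list `p` of directed edges is a directed edge path in `Γ` from `u` to `v`. -/
def IsPath : V → List D → V → Prop
  | u, [], v => u = v
  | u, e :: p, v => Γ.src e = u ∧ IsPath (Γ.tgt e) p v

/-- A path without backtracking: no edge is immediately followed by its opposite. -/
def IsReduced (p : List D) : Prop := p.IsChain (fun e f => f ≠ Γ.bar e)

/-- Any two vertices are joined by a path, and there is a vertex. -/
def Connected : Prop := Nonempty V ∧ ∀ u v : V, ∃ p : List D, Γ.IsPath u p v

/-- A subgraph: a set of vertices and a set of (undirected) edges with endpoints among them;
the set of edges is recorded as a set of directed edges that is closed under `bar`. -/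
structure Subgraph where
  verts : Set V
  edges : Set D
  bar_mem : ∀ e ∈ edges, Γ.bar e ∈ edges
  src_mem : ∀ e ∈ edges, Γ.src e ∈ verts

variable {Γ}

/-- `T₁` is contained in `T₂`. -/
def Subgraph.IsContainedIn (T₁ T₂ : Γ.Subgraph) : Prop :=
  T₁.verts ⊆ T₂.verts ∧ T₁.edges ⊆ T₂.edges

/-- `p` is a path without backtracking from `u` to `v` all of whose edges lie in `T`. -/
def Subgraph.IsReducedPath (T : Γ.Subgraph) (u : V) (p : List D) (v : V) : Prop :=
  Γ.IsPath u p v ∧ Γ.IsReduced p ∧ ∀ e ∈ p, e ∈ T.edges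

/-- A tree: a nonempty subgraph in which any two vertices are joined by exactly one path
without backtracking. -/
def Subgraph.IsTree (T : Γ.Subgraph) : Prop :=
  T.verts.Nonempty ∧ ∀ u ∈ T.verts, ∀ v ∈ T.verts, ∃! p : List D, T.IsReducedPath u p v

/-- A spanning tree of `Γ`. -/
def Subgraph.IsSpanningTree (T : Γ.Subgraph) : Prop :=
  T.verts = Set.univ ∧ T.IsTree

/-- `Φ` is a flow function on `Γ` with bound `K`, with respect to the spanning tree `T`. The value
of `Φ` on a directed edge `e` is a directed path, given by its list of edges and starting at the
starting point of `e`. -/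
structure IsFlowFunction (T : Γ.Subgraph) (Φ : D → List D) (K : ℕ) : Prop where
  isSpanningTree : T.IsSpanningTree
  isPath : ∀ e, Γ.IsPath (Γ.src e) (Φ e) (Γ.tgt e)
  length_le : ∀ e, (Φ e).length ≤ K
  eq_self : ∀ e ∈ T.edges, Φ e = [e]
  no_infinite_chain : ¬ ∃ s : ℕ → D, ∀ i, s i ∉ T.edges ∧ s (i + 1) ∈ Φ (s i)

end DirGraph

/-! ### Regular languages of tuples of words -/

/-- The padded word of an `n`-tuple of words: its length is the largest length in the tuple, its
`j`-th letter is the tuple of the `j`-th letters, where `none` is the padding symbol. -/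
def padded {A : Type*} {n : ℕ} (w : Fin n → List A) : List (Fin n → Option A) :=
  (List.range (Finset.univ.sup fun i => (w i).length)).map fun j i => (w i)[j]?

/-- A set of `n`-tuples of words is (synchronously) regular if the language of its padded words
is accepted by a finite state automaton. -/
def IsSyncRegular {A : Type*} {n : ℕ} (L : Set (Fin n → List A)) : Prop :=
  Language.IsRegular (padded '' L : Language (Fin n → Option A))

/-! ### Generating sets and Cayley graphs -/

/-- An inverse-closed generating set for the group `G`, with set of letters `A`: each letter
represents an element of `G`, each letter has an inverse letter, and no letter represents the
identity. Different letters may represent the same element. -/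
structure GenSet (G : Type*) [Group G] (A : Type*) where
  val : A → G
  inv : A → A
  inv_inv : ∀ a, inv (inv a) = a
  val_inv : ∀ a, val (inv a) = (val a)⁻¹
  val_ne_one : ∀ a, val a ≠ 1
  closure_eq_top : Subgroup.closure (Set.range val) = ⊤

namespace GenSet

variable {G : Type*} [Group G] {A : Type*} (S : GenSet G A)

/-- The element of `G` represented by a word. -/
def eval (w : List A) : G := (w.map S.val).prod

/-- The Cayley graph: the pair `(g, a)` is the directed edge with initial vertex `g` and
label `a`, ending at `g * a`. -/
def cayley : DirGraph G (G × A) where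
  src e := e.1
  tgt e := e.1 * S.val e.2
  bar e := (e.1 * S.val e.2, S.inv e.2)
  bar_bar e := by simp [S.inv_inv, S.val_inv]
  bar_ne e h := S.val_ne_one e.2 (by simpa using congrArg Prod.fst h)
  src_bar _ := rfl

/-- The label of a path in the Cayley graph. -/
def label (p : List (G × A)) : List A := p.map Prod.snd

/-- The normal forms given by a spanning tree `T` of the Cayley graph: the labels of the paths
without backtracking in `T` that start at the identity. -/
def normalForms (T : S.cayley.Subgraph) : Set (List A) :=
  {w | ∃ (p : List (G × A)) (g : G), T.IsReducedPath 1 p g ∧ w = label p}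

/-- The graph of the flow function `Φ`, as a set of triples of words. -/
def graph (T : S.cayley.Subgraph) (Φ : G × A → List (G × A)) : Set (Fin 3 → List A) :=
  {x | ∃ y ∈ S.normalForms T, ∃ a : A, x = ![y, [a], label (Φ (S.eval y, a))]}

/-- The conditions on a spanning tree `T` and a flow function `Φ` of the Cayley graph of `G` to
respect the subgroup `H`. -/
structure Respects (T : S.cayley.Subgraph) (Φ : G × A → List (G × A)) (H : Subgroup G) :
    Prop where
  /-- Subgroup closure and translation invariance, for an inverse-closed generating set `B` of
  `H`, a spanning tree `T_H` of the Cayley graph of `H` over `B`, and a subtree `T'` of `T`. -/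
  exists_data : ∃ (B : Set A) (T_H T' : S.cayley.Subgraph),
    (∀ b ∈ B, S.inv b ∈ B) ∧
    Subgroup.closure (S.val '' B) = H ∧
    -- subgroup closure
    T_H.verts = (H : Set G) ∧ T_H.edges ⊆ {e | e.1 ∈ H ∧ e.2 ∈ B} ∧ T_H.IsTree ∧
    T_H.IsContainedIn T ∧
    (∀ h ∈ H, ∀ b ∈ B, ∀ c ∈ label (Φ (h, b)), c ∈ B) ∧
    -- translation invariance of the tree
    T'.IsTree ∧ T'.IsContainedIn T ∧ 1 ∈ T'.verts ∧
    T.verts = T_H.verts ∪ ⋃ h ∈ H, (fun g => h * g) '' T'.verts ∧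
    T.edges = T_H.edges ∪ ⋃ h ∈ H, (fun e : G × A => (h * e.1, e.2)) '' T'.edges ∧
    (∀ h ∈ H, ∀ k ∈ H, h ≠ k →
      Disjoint ((fun g => h * g) '' T'.verts) ((fun g => k * g) '' T'.verts)) ∧
    (∀ h ∈ H, ((fun g => h * g) '' T'.verts) ∩ T_H.verts = {h}) ∧
    -- translation invariance of the labels outside the Cayley graph of `H`
    (∀ g a, ¬ (g ∈ H ∧ a ∈ B) → ∀ h ∈ H, label (Φ (g, a)) = label (Φ (h * g, a)))

end GenSet

/-- `G` is stackable: over some finite generating set it admits a bounded flow function. -/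
def Stackable (G : Type*) [Group G] : Prop :=
  ∃ (A : Type) (_ : Finite A) (S : GenSet G A) (T : S.cayley.Subgraph)
    (Φ : G × A → List (G × A)) (K : ℕ), DirGraph.IsFlowFunction T Φ K

/-- `G` is autostackable: over some finite generating set it admits a bounded flow function
whose graph is regular. -/
def Autostackable (G : Type*) [Group G] : Prop :=
  ∃ (A : Type) (_ : Finite A) (S : GenSet G A) (T : S.cayley.Subgraph)
    (Φ : G × A → List (G × A)) (K : ℕ), DirGraph.IsFlowFunction T Φ K ∧
      IsSyncRegular (S.graph T Φ)

/-- `G` is stackable respecting the subgroup `H`. -/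
def StackableRespecting {G : Type*} [Group G] (H : Subgroup G) : Prop :=
  ∃ (A : Type) (_ : Finite A) (S : GenSet G A) (T : S.cayley.Subgraph)
    (Φ : G × A → List (G × A)) (K : ℕ), DirGraph.IsFlowFunction T Φ K ∧
      S.Respects T Φ H

/-- `G` is autostackable respecting the subgroup `H`. -/
def AutostackableRespecting {G : Type*} [Group G] (H : Subgroup G) : Prop :=
  ∃ (A : Type) (_ : Finite A) (S : GenSet G A) (T : S.cayley.Subgraph)
    (Φ : G × A → List (G × A)) (K : ℕ), DirGraph.IsFlowFunction T Φ K ∧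
      IsSyncRegular (S.graph T Φ) ∧ S.Respects T Φ H

/-! ### Graphs of groups -/

/-- A graph with vertex set `V` and set of undirected edges `E`, each with a reference direction:
the edge `e` joins `ends e false` to `ends e true`. -/
structure EdgeGraph (V E : Type*) where
  ends : E → Bool → V

/-- Each undirected edge `e` underlies two opposite directed edges, `(e, true)` and `(e, false)`;
the directed edge `(e, b)` goes from `ends e (!b)` to `ends e b`. -/
def EdgeGraph.toDirGraph {V E : Type*} (Λ : EdgeGraph V E) : DirGraph V (E × Bool) where
  src d := Λ.ends d.1 (!d.2)
  tgt d := Λ.ends d.1 d.2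
  bar d := (d.1, !d.2)
  bar_bar d := by simp
  bar_ne d h := by simpa using congrArg Prod.snd h
  src_bar d := by simp

/-- A graph of groups over `Λ`. Edge groups are indexed by undirected edges, so that opposite
directed edges have the same edge group. -/
structure GraphOfGroups.{u, v, w₁, w₂} {V : Type u} {E : Type v} (Λ : EdgeGraph V E) where
  vertexGroup : V → Type w₁
  edgeGroup : E → Type w₂
  [vertexGroupGroup : ∀ v, Group (vertexGroup v)]
  [edgeGroupGroup : ∀ e, Group (edgeGroup e)]
  hom : ∀ d : E × Bool, edgeGroup d.1 →* vertexGroup (Λ.toDirGraph.tgt d)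
  hom_injective : ∀ d, Function.Injective (hom d)

attribute [instance] GraphOfGroups.vertexGroupGroup GraphOfGroups.edgeGroupGroup

namespace GraphOfGroups

variable {V E : Type*} {Λ : EdgeGraph V E} (𝒢 : GraphOfGroups Λ) (τ : Λ.toDirGraph.Subgraph)

/-- The free product of all vertex groups and of the free group on the directed edges that are
not in `τ`. -/
abbrev FreeProd : Type _ :=
  Monoid.Coprod (Monoid.CoprodI 𝒢.vertexGroup) (FreeGroup {d : E × Bool // d ∉ τ.edges})

/-- An element of a vertex group, in the free product. -/
def ofVertex (v : V) : 𝒢.vertexGroup v →* 𝒢.FreeProd τ :=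
  Monoid.Coprod.inl.comp Monoid.CoprodI.of

/-- A directed edge that is not in `τ`, in the free product. -/
def ofEdge (d : E × Bool) (hd : d ∉ τ.edges) : 𝒢.FreeProd τ :=
  Monoid.Coprod.inr (FreeGroup.of ⟨d, hd⟩)

/-- The defining relations `x = y` of the fundamental group, as pairs `(x, y)`. -/
inductive Rel : 𝒢.FreeProd τ → 𝒢.FreeProd τ → Prop
  /-- The opposite of an edge outside `τ` is its inverse. -/
  | bar (d : E × Bool) (hd : d ∉ τ.edges) (hd' : Λ.toDirGraph.bar d ∉ τ.edges) :
      Rel (𝒢.ofEdge τ (Λ.toDirGraph.bar d) hd') (𝒢.ofEdge τ d hd)⁻¹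
  /-- The edge group of an edge in `τ` is amalgamated. -/
  | tree (d : E × Bool) (hd : d ∈ τ.edges) (g : 𝒢.edgeGroup d.1) :
      Rel (𝒢.ofVertex τ _ (𝒢.hom d g)) (𝒢.ofVertex τ _ (𝒢.hom (Λ.toDirGraph.bar d) g))
  /-- An edge outside `τ` conjugates the two images of its edge group. -/
  | conj (d : E × Bool) (hd : d ∉ τ.edges) (g : 𝒢.edgeGroup d.1) :
      Rel (𝒢.ofEdge τ d hd * 𝒢.ofVertex τ _ (𝒢.hom d g) * (𝒢.ofEdge τ d hd)⁻¹)
        (𝒢.ofVertex τ _ (𝒢.hom (Λ.toDirGraph.bar d) g))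

/-- The normal subgroup generated by the relators `x * y⁻¹`. -/
def relators : Subgroup (𝒢.FreeProd τ) :=
  Subgroup.normalClosure {r | ∃ x y, 𝒢.Rel τ x y ∧ r = x * y⁻¹}

instance : (𝒢.relators τ).Normal := Subgroup.normalClosure_normal

/-- The fundamental group of the graph of groups `𝒢` at the spanning tree `τ`. -/
abbrev FundamentalGroup : Type _ := 𝒢.FreeProd τ ⧸ 𝒢.relators τ

end GraphOfGroups

end GoG

/-! Translation invariance turns the flow of a vertex group into a flow modulo the subgroup `H`. The
labels of the reduced paths in `T'` from 1 are representatives of the right cosets of `H`; outside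
the Cayley graph of `H` the flow label depends only on the representative; and no infinite flow
chain avoids both the tree and that Cayley graph. This is `FlowData.IsFlow`, supplied by
`exists_isFlow_of_respects`. Conversely, flow data modulo the trivial subgroup yield a flow function
(`exists_isFlowFunction`).

Elements of the fundamental group are products `g₀ e₁ w₁ e₂ w₂ ⋯` along edge paths from a base
vertex, with `g₀` a normal form in the base vertex group and `wᵢ` a coset representative modulo the
image of the edge group of `eᵢ`, nonempty wherever the path would backtrack. They exist because edge
group elements can be pushed to the left (`IsFrame.mul`). For a fixed end vertex they are unique
(`IsFrame.unique`), because the fundamental group acts on reduced sequences (`exists_action`).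
Moving the end vertex along the spanning tree changes no letters, so the words are unique outright.

For a letter `a` of a vertex group at `g`, take the reduced sequence of `g` that ends at that
vertex, with last piece `w` of type `j`. If `a` has another type, it is respelled in letters of type
`j`. If `w` is empty and `a` lies in `B`, the flow crosses the preceding edge backwards, spells the
edge group element in the earlier vertex group, and returns. Otherwise the flow of piece `j` is
used. Edges labelled by an edge of the graph outside the tree all lie in the new spanning tree.
Termination is lexicographic: crossing back shortens the sequence, respelling happens once per
level, and the flow within a level is well-founded (`acc_of_frame`).

Normal forms are read along walks in a finite graph with regular labels, and the flow depends only
on the last piece, so regularity carries over (`piFlow_isRegular`). -/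

namespace GoG

/-! ### Regular languages through left quotients -/

section Regular

variable {α β : Type*}

/-- The left quotient of a set of words by a word. -/
def quot (L : Set (List α)) (x : List α) : Set (List α) := {y | x ++ y ∈ L}

/-- A set of words with finitely many left quotients. -/
def Reg (L : Set (List α)) : Prop := (Set.range (quot L)).Finite

/-- This is the Myhill–Nerode theorem. Counting quotients avoids constructing automata in all the
closure properties below. -/
theorem reg_iff {L : Set (List α)} : Reg L ↔ Language.IsRegular (L : Language α) :=
  Language.isRegular_iff_finite_range_leftQuotient.symm

theorem Reg.of_forall_mem {L : Set (List α)} {F : Set (Set (List α))} (hF : F.Finite)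
    (h : ∀ x, quot L x ∈ F) : Reg L :=
  hF.subset (by rintro _ ⟨x, rfl⟩; exact h x)

/-- Over a finite alphabet there are finitely many words shorter than `m`, so only the quotients by
long words have to be controlled. -/
theorem Reg.of_long [Finite α] {L : Set (List α)} (m : ℕ) {F : Set (Set (List α))} (hF : F.Finite)
    (h : ∀ x, m ≤ x.length → quot L x ∈ F) : Reg L := by
  refine Reg.of_forall_mem (hF.union ((List.finite_length_lt α m).image (quot L))) fun x => ?_
  rcases le_or_gt m x.length with hx | hx
  · exact Or.inl (h x hx)
  · exact Or.inr ⟨x, hx, rfl⟩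

theorem Reg.union {L M : Set (List α)} (hL : Reg L) (hM : Reg M) : Reg (L ∪ M) :=
  Reg.of_forall_mem (Set.Finite.image2 (· ∪ ·) hL hM) fun x =>
    ⟨_, ⟨x, rfl⟩, _, ⟨x, rfl⟩, rfl⟩

theorem Reg.inter {L M : Set (List α)} (hL : Reg L) (hM : Reg M) : Reg (L ∩ M) :=
  Reg.of_forall_mem (Set.Finite.image2 (· ∩ ·) hL hM) fun x =>
    ⟨_, ⟨x, rfl⟩, _, ⟨x, rfl⟩, rfl⟩

theorem Reg.compl {L : Set (List α)} (hL : Reg L) : Reg Lᶜ :=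
  Reg.of_forall_mem (Set.Finite.image (·ᶜ) hL) fun x => ⟨_, ⟨x, rfl⟩, rfl⟩

theorem Reg.empty : Reg (∅ : Set (List α)) :=
  Reg.of_forall_mem (Set.finite_singleton ∅) fun _ => rfl

/-- Every quotient consists of suffixes of words of `L`, and there are finitely many of those. -/
theorem Reg.of_finite {L : Set (List α)} (hL : L.Finite) : Reg L := by
  have hS : (⋃ y ∈ L, {z | z ∈ y.tails}).Finite :=
    hL.biUnion fun y _ => List.finite_toSet y.tails
  refine Reg.of_forall_mem hS.finite_subsets fun x z hz => ?_
  simp only [Set.mem_iUnion, Set.mem_ofPred_eq, List.mem_tails]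
  exact ⟨_, hz, List.suffix_append _ _⟩

theorem Reg.biUnion {ι : Type*} {s : Set ι} (hs : s.Finite) {L : ι → Set (List α)}
    (hL : ∀ i ∈ s, Reg (L i)) : Reg (⋃ i ∈ s, L i) := by
  induction s, hs using Set.Finite.induction_on with
  | empty => simpa using Reg.empty
  | insert _ _ ih =>
    rw [Set.biUnion_insert]
    exact (hL _ (Set.mem_insert _ _)).union (ih fun i hi => hL i (Set.mem_insert_of_mem _ hi))

theorem Reg.iUnion {ι : Type*} [Finite ι] {L : ι → Set (List α)} (hL : ∀ i, Reg (L i)) :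
    Reg (⋃ i, L i) := by
  simpa using Reg.biUnion (Set.finite_univ (α := ι)) fun i _ => hL i

theorem Reg.and_const {L : Set (List α)} (hL : Reg L) (p : Prop) : Reg {y | y ∈ L ∧ p} := by
  by_cases hp : p
  · simpa [hp] using hL
  · simpa [hp] using Reg.empty

theorem Reg.preimage_map {L : Set (List β)} (hL : Reg L) (f : α → β) : Reg {x | x.map f ∈ L} :=
  Reg.of_forall_mem (Set.Finite.image (fun Q : Set (List β) => {z | z.map f ∈ Q}) hL) fun x =>
    ⟨_, ⟨x.map f, rfl⟩, by ext z; simp [quot]⟩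

theorem Reg.image_map {L : Set (List α)} (hL : Reg L) {f : α → β} (hf : f.Injective) :
    Reg (List.map f '' L) := by
  refine Reg.of_forall_mem ((Set.Finite.image (fun Q => List.map f '' Q) hL).union
    (Set.finite_singleton ∅)) fun X => ?_
  by_cases hX : ∃ x : List α, X = x.map f
  · obtain ⟨x, rfl⟩ := hX
    refine Or.inl ⟨_, ⟨x, rfl⟩, ?_⟩
    ext Z
    simp only [quot, Set.mem_image, Set.mem_ofPred_eq]
    constructor
    · rintro ⟨z, hz, rfl⟩
      exact ⟨_, hz, by simp⟩
    · rintro ⟨y, hy, h⟩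
      obtain ⟨a, b, rfl, ha, rfl⟩ := List.map_eq_append_iff.1 h
      obtain rfl := hf.list_map ha
      exact ⟨b, hy, rfl⟩
  · refine Or.inr (Set.eq_empty_of_forall_notMem fun Z => ?_)
    rintro ⟨y, hy, h⟩
    obtain ⟨a, b, rfl, ha, rfl⟩ := List.map_eq_append_iff.1 h
    exact hX ⟨a, ha.symm⟩

/-- The prefix `x` ends inside the first factor, leaving a quotient of `L` followed by `M`, or
inside the second, leaving a quotient of `M`. Hence a quotient of `L` and a set of quotients of `M`
determine the result. -/
theorem Reg.mul {L M : Set (List α)} (hL : Reg L) (hM : Reg M) :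
    Reg (Set.image2 (· ++ ·) L M) := by
  refine Reg.of_forall_mem (Set.Finite.image2
    (fun (Q : Set (List α)) (S : Set (Set (List α))) => Set.image2 (· ++ ·) Q M ∪ ⋃₀ S)
    hL hM.finite_subsets) fun x => ?_
  refine ⟨_, ⟨x, rfl⟩, {Q | ∃ x₁ x₂, x = x₁ ++ x₂ ∧ x₁ ∈ L ∧ Q = quot M x₂}, ?_, ?_⟩
  · rintro _ ⟨x₁, x₂, -, -, rfl⟩
    exact ⟨x₂, rfl⟩
  · ext z
    constructor
    · rintro (⟨y, hy, w, hw, rfl⟩ | ⟨_, ⟨x₁, x₂, rfl, h₁, rfl⟩, hz⟩)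
      · exact ⟨_, hy, w, hw, by simp⟩
      · exact ⟨x₁, h₁, _, hz, by simp⟩
    · rintro ⟨y, hy, w, hw, h⟩
      rcases List.append_eq_append_iff.1 h with ⟨c, rfl, rfl⟩ | ⟨c, rfl, rfl⟩
      · exact Or.inr ⟨_, ⟨y, c, rfl, hy, rfl⟩, hw⟩
      · exact Or.inl ⟨c, hy, w, hw, rfl⟩

theorem Reg.head_condition (P : α → Prop) : Reg {y : List α | ∀ a ∈ y.head?, P a} := by
  refine Reg.of_forall_mem (Set.toFinite {{y : List α | ∀ a ∈ y.head?, P a}, Set.univ, ∅})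
    fun x => ?_
  rcases x with _ | ⟨a, x⟩
  · exact Or.inl rfl
  · by_cases h : P a
    · exact Or.inr (Or.inl (Set.eq_univ_of_forall fun z => by simpa [quot] using h))
    · exact Or.inr (Or.inr (Set.eq_empty_of_forall_notMem fun z => by simpa [quot] using h))

/-- The words that are read along the walks from `i` to the last argument in a directed graph with
languages as labels. -/
inductive Walks {J : Type*} (C : J → J → Set (List α)) (i : J) : J → List α → Prop
  | nil : Walks C i i []
  | snoc {j k : J} {x y : List α} : Walks C i j x → y ∈ C j k → Walks C i k (x ++ y)

theorem Walks.trans {J : Type*} {C : J → J → Set (List α)} {i j k : J} {x y : List α}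
    (h : Walks C i j x) (h' : Walks C j k y) : Walks C i k (x ++ y) := by
  induction h' with
  | nil => simpa using h
  | snoc _ hy ih => simpa using ih.snoc hy

/-- The cut after a nonempty prefix falls within some step of the walk; only a walk without steps
has none to cut, hence the alternative `x = []`. -/
theorem Walks.split {J : Type*} {C : J → J → Set (List α)} {i j : J} {w : List α}
    (h : Walks C i j w) : ∀ x z, w = x ++ z → x = [] ∨ ∃ l k x₁ x₂ z₁ z₂,
      x = x₁ ++ x₂ ∧ z = z₁ ++ z₂ ∧ Walks C i l x₁ ∧ x₂ ++ z₁ ∈ C l k ∧ Walks C k j z₂ := by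
  induction h with
  | nil =>
    intro x z h
    exact Or.inl (List.append_eq_nil_iff.1 h.symm).1
  | @snoc j k w y hw hy ih =>
    intro x z h
    rcases List.append_eq_append_iff.1 h with ⟨c, rfl, rfl⟩ | ⟨c, rfl, rfl⟩
    · exact Or.inr ⟨_, _, w, c, z, [], rfl, by simp, hw, hy, .nil⟩
    · refine (ih x c rfl).imp id ?_
      rintro ⟨l, m, x₁, x₂, z₁, z₂, rfl, rfl, h₁, h₂, h₃⟩
      exact ⟨l, m, x₁, x₂, z₁, z₂ ++ y, rfl, by simp, h₁, h₂, h₃.snoc hy⟩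

/-- After reading a nonempty `x`, what matters is the set of possible pairs: the remaining language
of the step being read, and the vertex where this step ends. There are finitely many such pairs, so
finitely many sets of them. -/
theorem Reg.walks {J : Type*} [Finite J] {C : J → J → Set (List α)} (hC : ∀ i j, Reg (C i j))
    (i j : J) : Reg {x | Walks C i j x} := by
  have hU : {p : Set (List α) × J | ∃ l k, p.1 ∈ Set.range (quot (C l k))}.Finite := by
    have : (⋃ l, ⋃ k, Set.range (quot (C l k))).Finite :=
      Set.finite_iUnion fun l => Set.finite_iUnion fun k => hC l k
    refine (this.prod (Set.finite_univ (α := J))).subset ?_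
    rintro ⟨Q, m⟩ ⟨l, k, h⟩
    simp only [Set.mem_prod, Set.mem_iUnion, Set.mem_univ, and_true]
    exact ⟨l, k, h⟩
  refine Reg.of_forall_mem ((hU.finite_subsets.image fun S =>
    {z | ∃ p ∈ S, ∃ z₁ z₂, z = z₁ ++ z₂ ∧ z₁ ∈ p.1 ∧ Walks C p.2 j z₂}).union
      (Set.finite_singleton {x | Walks C i j x})) fun x => ?_
  rcases eq_or_ne x [] with rfl | hx
  · exact Or.inr rfl
  refine Or.inl ⟨{p | ∃ l x₁ x₂, x = x₁ ++ x₂ ∧ Walks C i l x₁ ∧ p.1 = quot (C l p.2) x₂}, ?_, ?_⟩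
  · rintro ⟨Q, k⟩ ⟨l, x₁, x₂, -, -, h⟩
    exact ⟨l, k, x₂, h.symm⟩
  · ext z
    constructor
    · rintro ⟨⟨Q, k⟩, ⟨l, x₁, x₂, rfl, h₁, hQ⟩, z₁, z₂, rfl, h₂, h₃⟩
      dsimp only at hQ h₂ h₃
      subst hQ
      have := (h₁.snoc h₂).trans h₃
      simpa [quot] using this
    · intro hz
      obtain h | ⟨l, k, x₁, x₂, z₁, z₂, h₁, h₂, h₃, h₄, h₅⟩ := Walks.split hz x z rfl
      · exact absurd h hx
      · exact ⟨⟨quot (C l k) x₂, k⟩, ⟨l, x₁, x₂, h₁, h₃, rfl⟩, z₁, z₂, h₂, h₄, h₅⟩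

end Regular

/-! ### Regular sets of triples whose second and third components are fixed -/

section Padded

variable {A : Type*}

theorem padded_length {n : ℕ} (w : Fin n → List A) :
    (padded w).length = Finset.univ.sup fun i => (w i).length := by
  simp [padded]

theorem padded_getElem? {n : ℕ} (w : Fin n → List A) (j : ℕ) :
    (padded w)[j]? = if j < Finset.univ.sup (fun i => (w i).length) then
      some (fun i => (w i)[j]?) else none := by
  simp only [padded, List.getElem?_map]
  split_ifs with h
  · rw [List.getElem?_range h]; rfl
  · rw [List.getElem?_eq_none (by simpa using h)]; rfl

theorem padded_bind {n : ℕ} (w : Fin n → List A) (i : Fin n) (j : ℕ) :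
    ((padded w)[j]?).bind (fun c => c i) = (w i)[j]? := by
  rw [padded_getElem?]
  split_ifs with h
  · rfl
  · have : (w i).length ≤ Finset.univ.sup fun i => (w i).length :=
      Finset.le_sup (f := fun i => (w i).length) (Finset.mem_univ i)
    rw [List.getElem?_eq_none (by omega)]; rfl

theorem padded_injective {n : ℕ} : Function.Injective (padded (A := A) (n := n)) := by
  intro w w' h
  funext i
  apply List.ext_getElem?
  intro j
  rw [← padded_bind, ← padded_bind, h]

/-- Once `x` is nonempty and at least as long as `u`, the second and third tracks are exhausted, and
further letters of the first track meet only padding. -/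
theorem padded_triple_append (a : A) (u x z : List A) (hx : 1 ≤ x.length)
    (hu : u.length ≤ x.length) :
    padded ![x ++ z, [a], u] = padded ![x, [a], u] ++ z.map fun c => ![some c, none, none] := by
  have hs : ∀ y : List A, x.length ≤ y.length →
      (Finset.univ.sup fun i => (![y, [a], u] i).length) = y.length := by
    intro y hy
    apply le_antisymm
    · apply Finset.sup_le
      intro i _
      fin_cases i <;> simp <;> omega
    · exact Finset.le_sup (f := fun i => (![y, [a], u] i).length) (Finset.mem_univ 0)
  have h₁ := hs (x ++ z) (by simp)
  have h₂ := hs x le_rfl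
  have hl : (padded ![x, [a], u]).length = x.length := by rw [padded_length, h₂]
  apply List.ext_getElem?
  intro j
  rcases lt_or_ge j x.length with hj | hj
  · rw [List.getElem?_append_left (by omega), padded_getElem?, padded_getElem?, h₁, h₂,
      if_pos hj, if_pos (by simp; omega)]
    congr 1
    funext i
    fin_cases i
    · simp [List.getElem?_append_left hj]
    · rfl
    · rfl
  · rw [List.getElem?_append_right (by omega), padded_getElem?, h₁, hl, List.getElem?_map]
    split_ifs with h
    · have hz : j - x.length < z.length := by simp at h; omega
      rw [List.getElem?_eq_getElem hz]
      simp only [Option.map_some, Option.some.injEq]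
      funext i
      fin_cases i
      · simp [List.getElem?_append_right hj, List.getElem?_eq_getElem hz]
      · simp; omega
      · simp; omega
    · have hz : z.length ≤ j - x.length := by simp at h; omega
      rw [List.getElem?_eq_none hz]
      rfl

/-- For long `x` the quotient by `x` is the preimage, under the letterwise coding with two padding
symbols, of the quotient of the padded language by the padding of `x`. -/
theorem Reg.triple_section [Finite A] {P : Set (Fin 3 → List A)} (hP : Reg (padded '' P))
    (a : A) (u : List A) : Reg {y | ![y, [a], u] ∈ P} := by
  refine Reg.of_long (max 1 u.length) (Set.Finite.image
    (fun Q => {z : List A | (z.map fun c => ![some c, none, none]) ∈ Q}) hP) fun x hx => ?_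
  refine ⟨_, ⟨padded ![x, [a], u], rfl⟩, ?_⟩
  ext z
  simp only [quot, Set.mem_ofPred_eq]
  rw [← padded_triple_append a u x z (by omega) (by omega), padded_injective.mem_set_image]

/-- Short first components contribute finitely many words. For the others, a quotient by a long word
is empty or a recoding of a quotient of `L`. -/
theorem Reg.triple_image [Finite A] {L : Set (List A)} (hL : Reg L) (a : A) (u : List A) :
    Reg (padded '' {x | ∃ y ∈ L, x = ![y, [a], u]}) := by
  set m := max 1 u.length with hm
  have hsplit : padded '' {x | ∃ y ∈ L, x = ![y, [a], u]} =
      ((fun y => padded ![y, [a], u]) '' (L ∩ {y | y.length < m})) ∪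
      ((fun y => padded ![y, [a], u]) '' (L ∩ {y | m ≤ y.length})) := by
    rw [← Set.image_union, ← Set.inter_union_distrib_left]
    have : ({y : List A | y.length < m} ∪ {y | m ≤ y.length}) = Set.univ :=
      Set.eq_univ_of_forall fun y => lt_or_ge y.length m
    rw [this, Set.inter_univ]
    ext X
    simp only [Set.mem_image, Set.mem_ofPred_eq]
    constructor
    · rintro ⟨_, ⟨y, hy, rfl⟩, rfl⟩
      exact ⟨y, hy, rfl⟩
    · rintro ⟨y, hy, rfl⟩
      exact ⟨_, ⟨y, hy, rfl⟩, rfl⟩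
  rw [hsplit]
  refine Reg.union (Reg.of_finite ?_) ?_
  · exact ((List.finite_length_lt A m).subset Set.inter_subset_right).image _
  have hlen : ∀ y : List A, m ≤ y.length → (padded ![y, [a], u]).length = y.length := by
    intro y hy
    rw [padded_length]
    apply le_antisymm
    · apply Finset.sup_le
      intro i _
      fin_cases i <;> simp <;> omega
    · exact Finset.le_sup (f := fun i => (![y, [a], u] i).length) (Finset.mem_univ 0)
  refine Reg.of_long m ((Set.Finite.image
    (fun Q => (List.map fun c => ![some c, none, none]) '' Q) hL).union
    (Set.finite_singleton ∅)) fun X hX => ?_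
  by_cases h : ∃ x, m ≤ x.length ∧ X = padded ![x, [a], u]
  · obtain ⟨x, hx, rfl⟩ := h
    refine Or.inl ⟨_, ⟨x, rfl⟩, ?_⟩
    ext Z
    constructor
    · rintro ⟨z, hz, rfl⟩
      exact ⟨x ++ z, ⟨hz, by simp; omega⟩,
        padded_triple_append a u x z (by omega) (by omega)⟩
    · rintro ⟨y, ⟨hy, hmy⟩, h⟩
      have h' : padded ![y, [a], u] = padded ![x, [a], u] ++ Z := h
      have hl := congrArg List.length h'
      rw [List.length_append, hlen y hmy, hlen x hx] at hl
      have hy' : y = y.take x.length ++ y.drop x.length := (List.take_append_drop _ _).symm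
      have htl : (y.take x.length).length = x.length := by simp; omega
      rw [hy', padded_triple_append a u _ _ (by omega) (by omega)] at h'
      obtain ⟨h₁, h₂⟩ := List.append_inj h' (by rw [hlen _ (by omega), hlen x hx, htl])
      have := congrFun (padded_injective h₁) 0
      simp only [Matrix.cons_val_zero] at this
      refine ⟨y.drop x.length, ?_, h₂⟩
      show x ++ y.drop x.length ∈ L
      rw [← this, htl, List.take_append_drop]
      exact hy
  · refine Or.inr (Set.eq_empty_of_forall_notMem fun Z => ?_)
    rintro ⟨y, ⟨hy, hmy⟩, h'⟩
    replace h' : padded ![y, [a], u] = X ++ Z := h'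
    have hl := congrArg List.length h'
    rw [List.length_append, hlen y hmy] at hl
    have hy' : y = y.take X.length ++ y.drop X.length := (List.take_append_drop _ _).symm
    have htl : (y.take X.length).length = X.length := by simp; omega
    rw [hy', padded_triple_append a u _ _ (by omega) (by omega)] at h'
    obtain ⟨h₁, h₂⟩ := List.append_inj h' (by rw [hlen _ (by omega), htl])
    exact h ⟨_, by omega, h₁.symm⟩

end Padded


/-! ### Paths -/

namespace DirGraph

variable {V D : Type*} {Γ : DirGraph V D}

theorem isPath_append {u v : V} {p q : List D} :
    Γ.IsPath u (p ++ q) v ↔ ∃ w, Γ.IsPath u p w ∧ Γ.IsPath w q v := by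
  induction p generalizing u with
  | nil => simp [IsPath]
  | cons e p ih => simp [IsPath, ih]; tauto

theorem isPath_singleton {u v : V} {e : D} :
    Γ.IsPath u [e] v ↔ Γ.src e = u ∧ Γ.tgt e = v := Iff.rfl

theorem tgt_bar (e : D) : Γ.tgt (Γ.bar e) = Γ.src e := by
  rw [← Γ.src_bar, Γ.bar_bar]

theorem isReduced_snoc {p : List D} {e : D} :
    Γ.IsReduced (p ++ [e]) ↔ Γ.IsReduced p ∧ ∀ f ∈ p.getLast?, e ≠ Γ.bar f := by
  unfold IsReduced
  rw [List.isChain_append]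
  simp

theorem Subgraph.tgt_mem (T : Γ.Subgraph) {e : D} (he : e ∈ T.edges) : Γ.tgt e ∈ T.verts := by
  rw [← Γ.src_bar]
  exact T.src_mem _ (T.bar_mem e he)

theorem Subgraph.IsReducedPath.of_append {T : Γ.Subgraph} {u v : V} {p q : List D}
    (h : T.IsReducedPath u (p ++ q) v) : ∃ w, T.IsReducedPath u p w := by
  obtain ⟨h₁, h₂, h₃⟩ := h
  obtain ⟨w, hw, -⟩ := isPath_append.1 h₁
  exact ⟨w, hw, h₂.left_of_append, fun e he => h₃ e (List.mem_append_left _ he)⟩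

theorem Subgraph.IsReducedPath.mem_verts {T : Γ.Subgraph} {u v : V} {p : List D}
    (h : T.IsReducedPath u p v) (hu : u ∈ T.verts) : v ∈ T.verts := by
  rcases List.eq_nil_or_concat' p with rfl | ⟨q, e, rfl⟩
  · rwa [← h.1]
  · obtain ⟨w, -, hw⟩ := isPath_append.1 h.1
    rw [← (isPath_singleton.1 hw).2]
    exact T.tgt_mem (h.2.2 e (by simp))

theorem Subgraph.IsReducedPath.snoc {T : Γ.Subgraph} {u v : V} {p : List D}
    (h : T.IsReducedPath u p v) {e : D} (he : e ∈ T.edges) (hs : Γ.src e = v)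
    (hl : ∀ f ∈ p.getLast?, e ≠ Γ.bar f) : T.IsReducedPath u (p ++ [e]) (Γ.tgt e) := by
  refine ⟨isPath_append.2 ⟨v, h.1, hs, rfl⟩, isReduced_snoc.2 ⟨h.2.1, hl⟩, fun f hf => ?_⟩
  rcases List.mem_append.1 hf with hf | hf
  · exact h.2.2 f hf
  · rwa [List.mem_singleton.1 hf]

/-- The reduced path to the end of an edge arises from that to its start, or the other way round. -/
theorem Subgraph.IsReducedPath.extend {T : Γ.Subgraph} {u v : V} {p : List D}
    (h : T.IsReducedPath u p v) {e : D} (he : e ∈ T.edges) (hs : Γ.src e = v) :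
    T.IsReducedPath u (p ++ [e]) (Γ.tgt e) ∨
      ∃ q, p = q ++ [Γ.bar e] ∧ T.IsReducedPath u q (Γ.tgt e) := by
  by_cases hl : ∀ f ∈ p.getLast?, e ≠ Γ.bar f
  · exact Or.inl (h.snoc he hs hl)
  · push Not at hl
    obtain ⟨f, hf, rfl⟩ := hl
    rcases List.eq_nil_or_concat' p with rfl | ⟨q, f', rfl⟩
    · simp at hf
    · obtain rfl : f' = f := by simpa using hf
      refine Or.inr ⟨q, by simp [Γ.bar_bar], ?_⟩
      obtain ⟨w, hw, hw'⟩ := isPath_append.1 h.1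
      have hfw : Γ.src f' = w := hw'.1
      refine ⟨?_, h.2.1.left_of_append, fun e he => h.2.2 e (List.mem_append_left _ he)⟩
      rwa [tgt_bar, hfw]

end DirGraph

/-! ### Words and walks in Cayley graphs -/

namespace GenSet

variable {G : Type*} [Group G] {A : Type*} (S : GenSet G A)

@[simp] theorem eval_nil : S.eval [] = 1 := rfl

@[simp] theorem eval_append (u v : List A) : S.eval (u ++ v) = S.eval u * S.eval v := by
  simp [eval]

@[simp] theorem eval_cons (a : A) (v : List A) : S.eval (a :: v) = S.val a * S.eval v := by
  simp [eval]

theorem eval_surjective (g : G) : ∃ u, S.eval u = g := by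
  have hg : g ∈ Subgroup.closure (Set.range S.val) := by simp [S.closure_eq_top]
  induction hg using Subgroup.closure_induction with
  | mem x hx =>
    obtain ⟨a, rfl⟩ := hx
    exact ⟨[a], by simp⟩
  | one => exact ⟨[], rfl⟩
  | mul x y _ _ hx hy =>
    obtain ⟨u, rfl⟩ := hx
    obtain ⟨v, rfl⟩ := hy
    exact ⟨u ++ v, by simp⟩
  | inv x hx ih =>
    obtain ⟨u, rfl⟩ := ih
    clear hx
    induction u with
    | nil => exact ⟨[], by simp⟩
    | cons a u ih =>
      obtain ⟨v, hv⟩ := ih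
      exact ⟨v ++ [S.inv a], by simp [hv, S.val_inv]⟩

/-- The path in the Cayley graph that starts at `g` and has the given label. -/
def walk : G → List A → List (G × A)
  | _, [] => []
  | g, a :: u => (g, a) :: walk (g * S.val a) u

theorem walk_append (g : G) (u v : List A) :
    S.walk g (u ++ v) = S.walk g u ++ S.walk (g * S.eval u) v := by
  induction u generalizing g with
  | nil => simp [walk]
  | cons a u ih => simp [walk, ih, mul_assoc]

theorem label_walk (g : G) (u : List A) : label (S.walk g u) = u := by
  induction u generalizing g with
  | nil => rfl
  | cons a u ih => simpa [walk, label] using ih _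

theorem length_walk (g : G) (u : List A) : (S.walk g u).length = u.length := by
  simpa [label] using congrArg List.length (S.label_walk g u)

theorem isPath_walk (g : G) (u : List A) : S.cayley.IsPath g (S.walk g u) (g * S.eval u) := by
  induction u generalizing g with
  | nil => simp [walk, DirGraph.IsPath]
  | cons a u ih =>
    refine ⟨rfl, ?_⟩
    rw [eval_cons, ← mul_assoc]
    exact ih (g * S.val a)

variable {S}

/-- A path in a Cayley graph is determined by its start and its label, which allows flows to be
treated through words alone. -/
theorem eq_walk {g k : G} {p : List (G × A)} (h : S.cayley.IsPath g p k) :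
    p = S.walk g (label p) ∧ k = g * S.eval (label p) := by
  induction p generalizing g with
  | nil =>
    obtain rfl : g = k := h
    simp [walk, label]
  | cons e p ih =>
    obtain ⟨h₁, h₂⟩ := h
    obtain ⟨h₃, h₄⟩ := ih h₂
    obtain rfl : e.1 = g := h₁
    refine ⟨congrArg (e :: ·) h₃, ?_⟩
    change k = e.1 * S.val e.2 * _ at h₄
    rw [h₄, mul_assoc]
    exact congrArg _ (S.eval_cons _ _).symm

theorem mem_walk {g : G} {u : List A} {e : G × A} (h : e ∈ S.walk g u) :
    ∃ u₁ u₂, u = u₁ ++ e.2 :: u₂ ∧ e.1 = g * S.eval u₁ := by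
  induction u generalizing g with
  | nil => simp [walk] at h
  | cons a u ih =>
    rcases List.mem_cons.1 h with rfl | h
    · exact ⟨[], u, by simp⟩
    · obtain ⟨u₁, u₂, h₁, h₂⟩ := ih h
      exact ⟨a :: u₁, u₂, by simp [h₁], by simp [h₂, mul_assoc]⟩

omit [Group G] in
theorem label_append (p q : List (G × A)) : label (p ++ q) = label p ++ label q := by
  simp [label]

end GenSet

/-! ### Flow data relative to a subgroup, in terms of words -/

/-- A generating set with a set `B` of letters, a set `N` of normal forms with the map `nf` that
finds them, and a map `phi` that gives the label of the flow function. -/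
structure FlowData (G : Type*) [Group G] (A : Type*) where
  S : GenSet G A
  B : Set A
  N : Set (List A)
  nf : G → List A
  phi : List A → A → List A

namespace FlowData

variable {G : Type*} [Group G] {A : Type*} (F : FlowData G A)

/-- The edge `(g, a)` lies in a translate of the tree given by the normal forms. -/
def IsTreeEdge (e : G × A) : Prop :=
  F.nf e.1 ++ [e.2] ∈ F.N ∨ ∃ y, F.nf e.1 = y ++ [F.S.inv e.2]

/-- `e` is neither an edge of a translate of the tree nor one of the Cayley graph of `H`. -/
def IsActive (H : Subgroup G) (e : G × A) : Prop :=
  ¬ F.IsTreeEdge e ∧ ¬ (e.1 ∈ H ∧ e.2 ∈ F.B)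

/-- `e'` is an active edge of the path that the flow assigns to the active edge `e`. -/
def Step (H : Subgroup G) (e' e : G × A) : Prop :=
  F.IsActive H e' ∧ F.IsActive H e ∧ e' ∈ F.S.walk e.1 (F.phi (F.nf e.1) e.2)

/-- The normal forms are representatives of the right cosets of `H`, and the flow ends up in the
tree or in the Cayley graph of `H`. -/
structure IsFlow (H : Subgroup G) : Prop where
  val_mem : ∀ b ∈ F.B, F.S.val b ∈ H
  nil_mem : [] ∈ F.N
  of_append : ∀ y a, y ++ [a] ∈ F.N → y ∈ F.N
  notMem_B : ∀ b, [b] ∈ F.N → b ∉ F.B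
  nf_mem : ∀ g, F.nf g ∈ F.N
  nf_spec : ∀ g, ∃ h ∈ H, g = h * F.S.eval (F.nf g)
  nf_mul : ∀ h ∈ H, ∀ y ∈ F.N, F.nf (h * F.S.eval y) = y
  phi_eval : ∀ y ∈ F.N, ∀ a, F.S.eval (F.phi y a) = F.S.val a
  phi_bdd : ∃ K, ∀ y ∈ F.N, ∀ a, (F.phi y a).length ≤ K
  phi_up : ∀ y a, y ++ [a] ∈ F.N → F.phi y a = [a]
  phi_down : ∀ y a, y ++ [a] ∈ F.N → F.phi (y ++ [a]) (F.S.inv a) = [F.S.inv a]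
  wf : WellFounded (F.Step H)

/-- The normal forms and the graph of the flow are regular. -/
structure IsRegular : Prop where
  reg_N : Reg F.N
  reg_phi : ∀ a u, Reg {y | y ∈ F.N ∧ F.phi y a = u}

end FlowData

/-! ### Flow data from flow functions -/

section Extract

variable {G : Type*} [Group G] {A : Type*} {S : GenSet G A}

theorem wellFounded_of_no_chain {α : Type*} {r : α → α → Prop}
    (h : ¬ ∃ s : ℕ → α, ∀ i, r (s (i + 1)) (s i)) : WellFounded r := by
  rw [wellFounded_iff_isEmpty_descending_chain]
  exact ⟨fun s => h ⟨s.1, s.2⟩⟩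

/-- Each `g` is uniquely `h * t` with `h` in `H` and `t` in `T'`; `nf g` is the label of the reduced
path in `T'` to `t`, and `phi` reads the flow at `t`, which by invariance has the same label at `g`.
Active edges lie outside `T`, so an infinite chain of steps would be a forbidden chain for `Φ`. The
hypotheses are loose enough to cover both a respected subgroup and the trivial one with `T' = T`. -/
theorem exists_isFlow {T T' : S.cayley.Subgraph} {Φ : G × A → List (G × A)} {K : ℕ}
    (hΦ : DirGraph.IsFlowFunction T Φ K) {H : Subgroup G} {B : Set A}
    (hB : ∀ b ∈ B, S.val b ∈ H) (hT' : T'.IsTree) (hT'T : T'.edges ⊆ T.edges)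
    (h1 : (1 : G) ∈ T'.verts)
    (hcov : ∀ g, ∃ h ∈ H, ∃ t ∈ T'.verts, g = h * t)
    (hdisj : ∀ h ∈ H, ∀ t ∈ T'.verts, ∀ t' ∈ T'.verts, h * t = t' → h = 1)
    (hedge : ∀ e ∈ T.edges, (e.1 ∈ H ∧ e.2 ∈ B) ∨
      ∃ h ∈ H, ∃ e' ∈ T'.edges, e = (h * e'.1, e'.2))
    (hT'B : ∀ b ∈ B, ((1 : G), b) ∉ T'.edges)
    (hinv : ∀ g a, ¬ (g ∈ H ∧ a ∈ B) → ∀ h ∈ H,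
      GenSet.label (Φ (g, a)) = GenSet.label (Φ (h * g, a))) :
    ∃ F : FlowData G A, F.IsFlow H ∧ F.N = S.normalForms T' ∧
      F.phi = fun y a => GenSet.label (Φ (S.eval y, a)) := by
  have hpath : ∀ {p : List (G × A)} {g : G}, T'.IsReducedPath 1 p g →
      g ∈ T'.verts ∧ S.eval (GenSet.label p) = g := fun hp =>
    ⟨hp.mem_verts h1, by simpa using (GenSet.eq_walk hp.1).2.symm⟩
  have hex : ∀ g, ∃ h ∈ H, ∃ p : List (G × A), ∃ t, T'.IsReducedPath 1 p t ∧ g = h * t := by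
    intro g
    obtain ⟨h, hh, t, ht, rfl⟩ := hcov g
    obtain ⟨p, hp, -⟩ := hT'.2 1 h1 t ht
    exact ⟨h, hh, p, t, hp, rfl⟩
  choose hh hhH pp tt hpp htt using hex
  have huniq : ∀ h ∈ H, ∀ p g, T'.IsReducedPath 1 p g → pp (h * g) = p := by
    intro h hH p g hp
    have h₁ : hh (h * g) * tt (h * g) = h * g := (htt _).symm
    have h₂ : (h⁻¹ * hh (h * g)) * tt (h * g) = g := by rw [mul_assoc, h₁]; group
    have h₃ := hdisj _ (H.mul_mem (H.inv_mem hH) (hhH (h * g))) _ (hpath (hpp (h * g))).1 g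
      (hpath hp).1 h₂
    have h₄ : tt (h * g) = g := by rw [h₃] at h₂; simpa using h₂
    have h₅ := hpp (h * g)
    rw [h₄] at h₅
    exact (hT'.2 1 h1 g (hpath hp).1).unique h₅ hp
  have hlen : ∀ g a, GenSet.label (Φ (g, a)) = GenSet.label (Φ (S.eval (GenSet.label (pp g)), a)) ∨
      (g ∈ H ∧ a ∈ B) := by
    intro g a
    by_cases hg : g ∈ H ∧ a ∈ B
    · exact Or.inr hg
    · left
      rw [(hpath (hpp g)).2]
      have h₁ : tt g = (hh g)⁻¹ * g := by
        rw [eq_inv_mul_iff_mul_eq, ← htt]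
      rw [h₁]
      exact hinv g a hg _ (H.inv_mem (hhH g))
  have hΦwalk : ∀ e : G × A, Φ e = S.walk e.1 (GenSet.label (Φ e)) ∧
      e.1 * S.val e.2 = e.1 * S.eval (GenSet.label (Φ e)) := fun e =>
    GenSet.eq_walk (hΦ.isPath e)
  -- The last letter of a normal form comes from an edge of `T'` that starts at the element
  -- represented by the rest.
  have hlast : ∀ {y : List A} {a : A}, y ++ [a] ∈ S.normalForms T' →
      ∃ p, T'.IsReducedPath 1 p (S.eval y) ∧ y = GenSet.label p ∧ (S.eval y, a) ∈ T'.edges ∧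
        T'.IsReducedPath 1 (p ++ [(S.eval y, a)]) (S.eval y * S.val a) := by
    rintro y a ⟨q, g, hq, hy⟩
    rcases List.eq_nil_or_concat' q with rfl | ⟨p, e, rfl⟩
    · simp [GenSet.label] at hy
    · have hqe := hq
      obtain ⟨w, hw, hw'⟩ := DirGraph.isPath_append.1 hq.1
      rw [GenSet.label_append] at hy
      obtain ⟨h₁, h₂⟩ := List.append_inj' hy rfl
      have he : e = (w, a) := by
        have h₃ : e.1 = w := hw'.1
        have h₄ : a = e.2 := by simpa [GenSet.label] using h₂
        rw [← h₃, h₄]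
      have hwe : w = S.eval y := by simpa [h₁] using (GenSet.eq_walk hw).2
      subst hwe he
      refine ⟨p, ⟨hw, hq.2.1.left_of_append, fun e he => hq.2.2 e (List.mem_append_left _ he)⟩,
        h₁, hq.2.2 _ (by simp), ?_⟩
      have : g = S.eval y * S.val a := hw'.2.symm
      rwa [← this]
  let F : FlowData G A :=
    { S := S, B := B, N := S.normalForms T', nf := fun g => GenSet.label (pp g),
      phi := fun y a => GenSet.label (Φ (S.eval y, a)) }
  have hact : ∀ e, F.IsActive H e → e ∉ T.edges := by
    intro e he heT
    rcases hedge e heT with h | ⟨h, hH, e', he', rfl⟩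
    · exact he.2 h
    · obtain ⟨p, hp, -⟩ := hT'.2 1 h1 e'.1 (T'.src_mem _ he')
      have hnf : F.nf (h * e'.1) = GenSet.label p := by
        show GenSet.label (pp _) = _
        rw [huniq h hH p _ hp]
      refine he.1 ?_
      rcases hp.extend he' rfl with h₁ | ⟨q, h₁, h₂⟩
      · refine Or.inl ?_
        rw [hnf]
        exact ⟨_, _, h₁, by simp [GenSet.label]⟩
      · refine Or.inr ⟨GenSet.label q, ?_⟩
        rw [hnf, h₁, GenSet.label_append]
        rfl
  refine ⟨F, ?_, rfl, rfl⟩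
  constructor
  · exact hB
  · exact ⟨[], 1, ⟨rfl, List.isChain_nil, by simp⟩, rfl⟩
  · intro y a hy
    obtain ⟨p, hp, rfl, -⟩ := hlast hy
    exact ⟨p, _, hp, rfl⟩
  · intro b hb hbB
    obtain ⟨p, hp, -, he, -⟩ := hlast (y := []) hb
    exact hT'B b hbB he
  · intro g
    exact ⟨pp g, _, hpp g, rfl⟩
  · intro g
    refine ⟨hh g, hhH g, ?_⟩
    show g = hh g * S.eval (GenSet.label (pp g))
    rw [(hpath (hpp g)).2, ← htt]
  · rintro h hH _ ⟨p, g, hp, rfl⟩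
    show GenSet.label (pp (h * S.eval (GenSet.label p))) = _
    rw [(hpath hp).2, huniq h hH p g hp]
  · intro y _ a
    simpa using (hΦwalk (S.eval y, a)).2.symm
  · exact ⟨K, fun y _ a => by simpa [F, GenSet.label] using hΦ.length_le (S.eval y, a)⟩
  · intro y a hy
    obtain ⟨p, -, -, he, -⟩ := hlast hy
    show GenSet.label (Φ _) = _
    rw [hΦ.eq_self _ (hT'T he)]
    rfl
  · intro y a hy
    obtain ⟨p, -, -, he, -⟩ := hlast hy
    have hb := T'.bar_mem _ he
    show GenSet.label (Φ _) = _
    have : S.cayley.bar (S.eval y, a) = (S.eval (y ++ [a]), S.inv a) := by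
      simp [GenSet.cayley]
    rw [this] at hb
    rw [hΦ.eq_self _ (hT'T hb)]
    rfl
  · apply wellFounded_of_no_chain
    rintro ⟨s, hs⟩
    refine hΦ.no_infinite_chain ⟨s, fun i => ⟨hact _ (hs i).2.1, ?_⟩⟩
    have h₁ : s (i + 1) ∈ S.walk (s i).1 (GenSet.label (Φ (S.eval (GenSet.label (pp (s i).1)),
      (s i).2))) := (hs i).2.2
    rcases hlen (s i).1 (s i).2 with h₂ | h₂
    · rw [← h₂] at h₁
      rw [(hΦwalk (s i)).1]
      exact h₁
    · exact absurd h₂ (hs i).2.1.2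


theorem exists_isFlow_bot {T : S.cayley.Subgraph} {Φ : G × A → List (G × A)} {K : ℕ}
    (hΦ : DirGraph.IsFlowFunction T Φ K) :
    ∃ F : FlowData G A, F.IsFlow ⊥ ∧ F.N = S.normalForms T ∧
      F.phi = fun y a => GenSet.label (Φ (S.eval y, a)) := by
  have hv : T.verts = Set.univ := hΦ.isSpanningTree.1
  refine exists_isFlow (B := ∅) hΦ (by simp) hΦ.isSpanningTree.2 subset_rfl (by simp [hv])
    (fun g => ⟨1, one_mem _, g, by simp [hv]⟩) (fun h hh _ _ _ _ _ => hh)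
    (fun e he => Or.inr ⟨1, one_mem _, e, he, by simp⟩) (by simp) ?_
  rintro g a - h hh
  rw [Subgroup.mem_bot.1 hh, one_mul]

/-- The sections of the regular graph at a letter and a flow label are regular. The normal forms are
the union of the sections at one letter over the finitely many labels of length at most `K`; without
letters there is only the empty word. -/
theorem regular_normalForms [Finite A] {T : S.cayley.Subgraph} {Φ : G × A → List (G × A)} {K : ℕ}
    (hΦ : DirGraph.IsFlowFunction T Φ K) (hreg : IsSyncRegular (S.graph T Φ)) :
    Reg (S.normalForms T) ∧
      ∀ a u, Reg {y | y ∈ S.normalForms T ∧ GenSet.label (Φ (S.eval y, a)) = u} := by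
  have h2 : ∀ a u, Reg {y | y ∈ S.normalForms T ∧ GenSet.label (Φ (S.eval y, a)) = u} := by
    intro a u
    have := Reg.triple_section (reg_iff.2 hreg) a u
    convert this using 1
    ext y
    constructor
    · rintro ⟨hy, rfl⟩
      exact ⟨y, hy, a, rfl⟩
    · rintro ⟨y', hy', a', h⟩
      have h₀ := congrFun h 0
      have h₁ := congrFun h 1
      have h₂ := congrFun h 2
      simp at h₀ h₁ h₂
      subst h₀ h₁ h₂
      exact ⟨hy', rfl⟩
  refine ⟨?_, h2⟩
  rcases isEmpty_or_nonempty A with hA | ⟨⟨a⟩⟩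
  · exact Reg.of_finite (Set.toFinite _)
  · convert Reg.biUnion (List.finite_length_le A K) fun u _ => h2 a u using 1
    ext y
    simp only [Set.mem_iUnion, Set.mem_ofPred_eq, exists_prop]
    constructor
    · intro hy
      exact ⟨_, by simpa [GenSet.label] using hΦ.length_le (S.eval y, a), hy, rfl⟩
    · rintro ⟨u, -, hy, -⟩
      exact hy

/-- Translation of an edge of the Cayley graph. -/
def translate (h : G) (e : G × A) : G × A := (h * e.1, e.2)

theorem translate_injective (h : G) : Function.Injective (translate (A := A) h) := by
  rintro ⟨g, a⟩ ⟨g', a'⟩ h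
  simpa [translate] using h

theorem isPath_translate (h : G) {u v : G} {p : List (G × A)} (hp : S.cayley.IsPath u p v) :
    S.cayley.IsPath (h * u) (p.map (translate h)) (h * v) := by
  induction p generalizing u with
  | nil => exact congrArg (h * ·) hp
  | cons e p ih =>
    refine ⟨congrArg (h * ·) hp.1, ?_⟩
    have := ih hp.2
    rwa [show h * S.cayley.tgt e = S.cayley.tgt (translate h e) from (mul_assoc _ _ _).symm] at this

theorem isReduced_translate (h : G) {p : List (G × A)} (hp : S.cayley.IsReduced p) :
    S.cayley.IsReduced (p.map (translate h)) := by
  unfold DirGraph.IsReduced at *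
  rw [List.isChain_map]
  refine hp.imp fun e f hef hc => hef ?_
  apply translate_injective h
  rw [hc]
  simp [translate, GenSet.cayley, mul_assoc]

/-- Regularity rests on the description `hNT` of the normal forms of `T'` as those of `T` that do
not begin with a letter of `B`. -/
theorem exists_isFlow_of_respects [Finite A] {T : S.cayley.Subgraph} {Φ : G × A → List (G × A)}
    {K : ℕ} (hΦ : DirGraph.IsFlowFunction T Φ K) {H : Subgroup G} (hr : S.Respects T Φ H) :
    ∃ F : FlowData G A, F.IsFlow H ∧ (IsSyncRegular (S.graph T Φ) → F.IsRegular) := by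
  obtain ⟨B, T_H, T', -, hBH, hv, he, hTH, hTHT, -, hT', hT'T, h1, hTv, hTe, hd, hi, hinv⟩ :=
    hr.exists_data
  have hB : ∀ b ∈ B, S.val b ∈ H := fun b hb => hBH ▸ Subgroup.subset_closure ⟨b, hb, rfl⟩
  have hcov : ∀ g, ∃ h ∈ H, ∃ t ∈ T'.verts, g = h * t := by
    intro g
    have hg : g ∈ T.verts := by simp [hΦ.isSpanningTree.1]
    rw [hTv] at hg
    rcases hg with hg | hg
    · rw [hv] at hg
      exact ⟨g, hg, 1, h1, by simp⟩
    · simp only [Set.mem_iUnion] at hg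
      obtain ⟨h, hh, t, ht, rfl⟩ := hg
      exact ⟨h, hh, t, ht, rfl⟩
  have hedge : ∀ e ∈ T.edges, (e ∈ T_H.edges) ∨
      ∃ h ∈ H, ∃ e' ∈ T'.edges, e = (h * e'.1, e'.2) := by
    intro e he
    rw [hTe] at he
    rcases he with he | he
    · exact Or.inl he
    · simp only [Set.mem_iUnion] at he
      obtain ⟨h, hh, t, ht, rfl⟩ := he
      exact Or.inr ⟨h, hh, t, ht, rfl⟩
  -- The end of such an edge would lie in both `T'` and `H`, which meet only in 1, while no letter
  -- represents 1.
  have hT'B : ∀ b ∈ B, ((1 : G), b) ∉ T'.edges := by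
    intro b hb hbT
    have h₁ : S.val b ∈ T'.verts := by simpa [GenSet.cayley] using T'.tgt_mem hbT
    have h₂ : S.val b ∈ ((fun g => 1 * g) '' T'.verts) ∩ T_H.verts :=
      ⟨⟨_, h₁, one_mul _⟩, by rw [hv]; exact hB b hb⟩
    rw [hi 1 H.one_mem] at h₂
    exact S.val_ne_one b h₂
  obtain ⟨F, hF, hN, hphi⟩ := exists_isFlow hΦ hB hT' hT'T.2 h1 hcov (by
      intro h hh t ht t' ht' hht
      by_contra hne
      exact Set.disjoint_left.1 (hd h hh 1 H.one_mem hne) ⟨t, ht, hht⟩ ⟨t', ht', one_mul _⟩)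
    (fun e heT => (hedge e heT).imp (fun h => he h) id) hT'B hinv
  refine ⟨F, hF, fun hreg => ?_⟩
  obtain ⟨hreg₁, hreg₂⟩ := regular_normalForms hΦ hreg
  have hNT : S.normalForms T' = S.normalForms T ∩ {y | ∀ a ∈ y.head?, a ∉ B} := by
    ext y
    constructor
    · rintro ⟨p, g, hp, rfl⟩
      refine ⟨⟨p, g, ⟨hp.1, hp.2.1, fun e he => hT'T.2 (hp.2.2 e he)⟩, rfl⟩, ?_⟩
      intro a ha haB
      rcases p with _ | ⟨e, p⟩
      · simp [GenSet.label] at ha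
      · have h₁ : e.1 = 1 := hp.1.1
        obtain rfl : e.2 = a := by simpa [GenSet.label] using ha
        refine hT'B _ haB ?_
        rw [← h₁]
        exact hp.2.2 e (by simp)
    · rintro ⟨⟨p, g, hp, rfl⟩, hhead⟩
      obtain ⟨h, hh, t, ht, rfl⟩ := hcov g
      obtain ⟨q, hq, -⟩ := hTH.2 1 (by rw [hv]; exact H.one_mem) h (by rw [hv]; exact hh)
      obtain ⟨r, hr, -⟩ := hT'.2 1 h1 t ht
      have htr : ∀ e ∈ r.map (translate h), e ∈ T.edges := by
        intro e he
        obtain ⟨e', he', rfl⟩ := List.mem_map.1 he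
        rw [hTe]
        refine Or.inr ?_
        simp only [Set.mem_iUnion]
        exact ⟨h, hh, e', hr.2.2 e' he', rfl⟩
      -- The reduced path in `T` to `h * t` runs through `T_H` to `h` and then through the translate
      -- of `T'`. It does not backtrack at `h`, since edges of `T_H` have labels in `B` and those of
      -- `T'` at 1 do not. A nonempty first part makes the first letter lie in `B`.
      have hqr : T.IsReducedPath 1 (q ++ r.map (translate h)) (h * t) := by
        refine ⟨DirGraph.isPath_append.2 ⟨h, hq.1, ?_⟩, ?_, ?_⟩
        · simpa using isPath_translate h hr.1
        · unfold DirGraph.IsReduced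
          rw [List.isChain_append]
          refine ⟨hq.2.1, isReduced_translate h hr.2.1, ?_⟩
          intro e heq f hf hfe
          rcases r with _ | ⟨f', r⟩
          · simp at hf
          obtain rfl : translate h f' = f := by simpa using hf
          have h₁ := T_H.bar_mem e (hq.2.2 e (List.mem_of_getLast? heq))
          rw [← hfe] at h₁
          have h₂ : f'.1 = 1 := hr.1.1
          refine hT'B f'.2 (he h₁).2 ?_
          rw [← h₂]
          exact hr.2.2 f' (by simp)
        · intro e he
          rcases List.mem_append.1 he with he | he
          · exact hTHT.2 (hq.2.2 e he)
          · exact htr e he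
      have hT := hΦ.isSpanningTree
      obtain rfl := (hT.2.2 1 (by simp [hT.1]) (h * t) (by simp [hT.1])).unique hp hqr
      rcases q with _ | ⟨e, q⟩
      · obtain rfl : (1 : G) = h := hq.1
        refine ⟨r, t, hr, ?_⟩
        have : translate (A := A) (1 : G) = id := by
          funext e
          simp [translate]
        simp [this]
      · exact absurd (he (hq.2.2 e (by simp))).2 (hhead e.2 (by simp [GenSet.label]))
  have hhd : Reg {y : List A | ∀ a ∈ y.head?, a ∉ B} := Reg.head_condition _
  constructor
  · rw [hN, hNT]
    exact hreg₁.inter hhd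
  · intro a u
    rw [hN, hphi, hNT]
    convert (hreg₂ a u).inter hhd using 1
    ext y
    simp only [Set.mem_inter_iff, Set.mem_ofPred_eq]
    tauto

end Extract


/-! ### From normal forms to stackability -/

namespace FlowData

variable {G : Type*} [Group G] {A A' : Type*}

/-- Renaming of the letters of flow data. -/
def rename (F : FlowData G A) (e : A ≃ A') : FlowData G A' where
  S :=
    { val := fun a => F.S.val (e.symm a)
      inv := fun a => e (F.S.inv (e.symm a))
      inv_inv := fun a => by simp [F.S.inv_inv]
      val_inv := fun a => by simp [F.S.val_inv]
      val_ne_one := fun a => F.S.val_ne_one _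
      closure_eq_top := by
        rw [← F.S.closure_eq_top]
        exact congrArg _ (e.symm.surjective.range_comp F.S.val) }
  B := e.symm ⁻¹' F.B
  N := {y | y.map e.symm ∈ F.N}
  nf g := (F.nf g).map e
  phi y a := (F.phi (y.map e.symm) (e.symm a)).map e

theorem rename_eval (F : FlowData G A) (e : A ≃ A') (y : List A') :
    (F.rename e).S.eval y = F.S.eval (y.map e.symm) := by
  simp [GenSet.eval, rename, Function.comp_def]

theorem mem_rename_walk (F : FlowData G A) (e : A ≃ A') {g : G} {u : List A} {x : G × A'}
    (h : x ∈ (F.rename e).S.walk g (u.map e)) : (x.1, e.symm x.2) ∈ F.S.walk g u := by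
  induction u generalizing g with
  | nil => simp [GenSet.walk] at h
  | cons a u ih =>
    rcases List.mem_cons.1 h with rfl | h
    · simp [GenSet.walk]
    · refine List.mem_cons_of_mem _ (ih ?_)
      simpa [rename] using h

theorem rename_isTreeEdge (F : FlowData G A) (e : A ≃ A') (x : G × A') :
    (F.rename e).IsTreeEdge x ↔ F.IsTreeEdge (x.1, e.symm x.2) := by
  unfold IsTreeEdge
  refine or_congr ?_ ?_
  · simp [rename]
  · constructor
    · rintro ⟨y, hy⟩
      refine ⟨y.map e.symm, ?_⟩
      simpa [rename] using congrArg (List.map e.symm) hy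
    · rintro ⟨y, hy⟩
      refine ⟨y.map e, ?_⟩
      simpa [rename] using congrArg (List.map e) hy

theorem IsFlow.rename {F : FlowData G A} {H : Subgroup G} (hF : F.IsFlow H) (e : A ≃ A') :
    (F.rename e).IsFlow H := by
  constructor
  · exact fun b hb => hF.val_mem _ hb
  · exact hF.nil_mem
  · intro y a h
    exact hF.of_append (y.map e.symm) (e.symm a) (by simpa [FlowData.rename] using h)
  · exact fun b hb => hF.notMem_B _ hb
  · intro g
    simpa [FlowData.rename] using hF.nf_mem g
  · intro g
    obtain ⟨h, hh, hg⟩ := hF.nf_spec g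
    refine ⟨h, hh, ?_⟩
    rw [rename_eval]
    simpa [FlowData.rename] using hg
  · intro h hh y hy
    rw [rename_eval]
    show (F.nf _).map e = y
    rw [hF.nf_mul h hh _ hy]
    simp
  · intro y hy a
    rw [rename_eval]
    simpa [FlowData.rename] using hF.phi_eval _ hy (e.symm a)
  · obtain ⟨K, hK⟩ := hF.phi_bdd
    exact ⟨K, fun y hy a => by simpa [FlowData.rename] using hK _ hy (e.symm a)⟩
  · intro y a hy
    show (F.phi _ _).map e = _
    rw [hF.phi_up _ _ (by simpa [FlowData.rename] using hy)]
    simp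
  · intro y a hy
    have := hF.phi_down (y.map e.symm) (e.symm a) (by simpa [FlowData.rename] using hy)
    simp [FlowData.rename, this]
  · refine Subrelation.wf ?_ (InvImage.wf (fun x : G × A' => (x.1, e.symm x.2)) hF.wf)
    rintro x y ⟨h₁, h₂, h₃⟩
    refine ⟨⟨?_, h₁.2⟩, ⟨?_, h₂.2⟩, ?_⟩
    · rw [← rename_isTreeEdge]; exact h₁.1
    · rw [← rename_isTreeEdge]; exact h₂.1
    · apply mem_rename_walk
      simpa [FlowData.rename] using h₃

theorem IsRegular.rename {F : FlowData G A} (hF : F.IsRegular) (e : A ≃ A') :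
    (F.rename e).IsRegular := by
  constructor
  · exact hF.reg_N.preimage_map e.symm
  · intro a u
    convert (hF.reg_phi (e.symm a) (u.map e.symm)).preimage_map e.symm using 1
    ext y
    refine and_congr Iff.rfl ?_
    constructor
    · rintro rfl
      simp [FlowData.rename]
    · intro h
      simp [FlowData.rename, h]

end FlowData

/-! ### Changing the starting point of reduced paths -/

namespace DirGraph

variable {V D : Type*} {Γ : DirGraph V D}

theorem isReduced_cons {p : List D} {e : D} :
    Γ.IsReduced (e :: p) ↔ (∀ f ∈ p.head?, f ≠ Γ.bar e) ∧ Γ.IsReduced p := by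
  unfold IsReduced
  rw [List.isChain_cons]

theorem Subgraph.IsReducedPath.cons {T : Γ.Subgraph} {v : V} {p : List D} {e : D}
    (he : e ∈ T.edges) (h : T.IsReducedPath (Γ.tgt e) p v) (hh : ∀ f ∈ p.head?, f ≠ Γ.bar e) :
    T.IsReducedPath (Γ.src e) (e :: p) v :=
  ⟨⟨rfl, h.1⟩, isReduced_cons.2 ⟨hh, h.2.1⟩, fun f hf =>
    (List.mem_cons.1 hf).elim (fun h => h ▸ he) (h.2.2 f)⟩

/-- Moves the starting point of a reduced path along an edge. -/
theorem Subgraph.IsReducedPath.prepend {T : Γ.Subgraph} {v : V} {p : List D} {e : D}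
    (he : e ∈ T.edges) (h : T.IsReducedPath (Γ.tgt e) p v) :
    T.IsReducedPath (Γ.src e) (e :: p) v ∨
      ∃ q, p = Γ.bar e :: q ∧ T.IsReducedPath (Γ.src e) q v ∧
        ∀ f ∈ q.head?, f ≠ e := by
  by_cases hh : ∀ f ∈ p.head?, f ≠ Γ.bar e
  · exact Or.inl (h.cons he hh)
  · push Not at hh
    obtain ⟨f, hf, rfl⟩ := hh
    rcases p with _ | ⟨f, q⟩
    · simp at hf
    obtain rfl : f = Γ.bar e := by simpa using hf
    refine Or.inr ⟨q, rfl, ⟨?_, (isReduced_cons.1 h.2.1).2, fun f hf => h.2.2 f (by simp [hf])⟩, ?_⟩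
    · rw [← Γ.tgt_bar]
      exact h.1.2
    · intro f hf
      simpa [Γ.bar_bar] using (isReduced_cons.1 h.2.1).1 f hf

/-- Prepending the edge or cancelling it matches the reduced paths from its two ends. A lengthened
and a shortened path cannot coincide, because the shortened one never begins with `e`. -/
theorem Subgraph.existsUnique_of_edge {T : Γ.Subgraph} {v : V} {e : D} (he : e ∈ T.edges)
    (h : ∃! p, T.IsReducedPath (Γ.src e) p v) : ∃! p, T.IsReducedPath (Γ.tgt e) p v := by
  obtain ⟨p, hp, hu⟩ := h
  have hbe := T.bar_mem e he
  apply existsUnique_of_exists_of_unique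
  · have hp' : T.IsReducedPath (Γ.tgt (Γ.bar e)) p v := by rwa [Γ.tgt_bar]
    rcases hp'.prepend hbe with h | ⟨q, -, h, -⟩
    · exact ⟨_, by rwa [Γ.src_bar] at h⟩
    · exact ⟨_, by rwa [Γ.src_bar] at h⟩
  · intro q r hq hr
    rcases hq.prepend he with h₁ | ⟨q', rfl, h₁, h₂⟩ <;>
      rcases hr.prepend he with h₃ | ⟨r', rfl, h₃, h₄⟩
    · simpa using (hu _ h₁).trans (hu _ h₃).symm
    · have := (hu _ h₁).trans (hu _ h₃).symm
      subst this
      exact absurd rfl (h₄ e (by simp))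
    · have := (hu _ h₁).trans (hu _ h₃).symm
      subst this
      exact absurd rfl (h₂ e (by simp))
    · rw [(hu _ h₁).trans (hu _ h₃).symm]

end DirGraph

/-! ### The spanning tree and flow function of flow data modulo the trivial subgroup -/

namespace FlowData

variable {G : Type*} [Group G] {A : Type*} {F : FlowData G A}

namespace IsFlow

variable (hF : F.IsFlow ⊥)
include hF

theorem eval_nf (g : G) : F.S.eval (F.nf g) = g := by
  obtain ⟨h, hh, hg⟩ := hF.nf_spec g
  rw [Subgroup.mem_bot.1 hh, one_mul] at hg
  exact hg.symm

theorem nf_eval {y : List A} (hy : y ∈ F.N) : F.nf (F.S.eval y) = y := by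
  simpa using hF.nf_mul 1 (one_mem _) y hy

theorem nf_one : F.nf 1 = [] := by
  simpa using hF.nf_eval hF.nil_mem

theorem nf_up {g : G} {a : A} (h : F.nf g ++ [a] ∈ F.N) : F.nf (g * F.S.val a) = F.nf g ++ [a] := by
  simpa [hF.eval_nf] using hF.nf_eval h

theorem nf_down {g : G} {a : A} {y : List A} (h : F.nf g = y ++ [F.S.inv a]) :
    F.nf (g * F.S.val a) = y := by
  have hg : g = F.S.eval y * (F.S.val a)⁻¹ := by
    rw [← hF.eval_nf g, h]
    simp [F.S.val_inv]
  rw [hg, inv_mul_cancel_right]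
  exact hF.nf_eval (hF.of_append y (F.S.inv a) (h ▸ hF.nf_mem g))

end IsFlow

/-- The spanning tree of the Cayley graph given by the normal forms. -/
def tree (hF : F.IsFlow ⊥) : F.S.cayley.Subgraph where
  verts := Set.univ
  edges := {e | F.IsTreeEdge e}
  bar_mem := by
    rintro ⟨g, a⟩ (h | ⟨y, h⟩)
    · exact Or.inr ⟨F.nf g, by simp only [GenSet.cayley, F.S.inv_inv]; exact hF.nf_up h⟩
    · refine Or.inl ?_
      show F.nf (g * F.S.val a) ++ [F.S.inv a] ∈ F.N
      rw [hF.nf_down h]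
      have := hF.nf_mem g
      rwa [h] at this
  src_mem _ _ := Set.mem_univ _

/-- A reduced path from 1 in the tree only moves upwards: a last edge going down would undo the
letter just read, which is backtracking. -/
theorem label_eq_nf (hF : F.IsFlow ⊥) {p : List (G × A)} {g : G}
    (hp : (tree hF).IsReducedPath 1 p g) : GenSet.label p = F.nf g := by
  induction p using List.reverseRecOn generalizing g with
  | nil =>
    obtain rfl : (1 : G) = g := hp.1
    exact hF.nf_one.symm
  | append_singleton p e ih =>
    obtain ⟨k, hk⟩ := hp.of_append
    have hlab := ih hk
    obtain ⟨w, hw, hw'⟩ := DirGraph.isPath_append.1 hp.1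
    obtain rfl : k = w := by rw [(GenSet.eq_walk hw).2, (GenSet.eq_walk hk.1).2]
    obtain rfl : e.1 = k := hw'.1
    obtain rfl : e.1 * F.S.val e.2 = g := hw'.2
    rw [GenSet.label_append, hlab]
    rcases hp.2.2 e (by simp) with h | ⟨y, h⟩
    · exact (hF.nf_up h).symm
    · exfalso
      have hnf := hF.nf_down h
      rcases List.eq_nil_or_concat' p with rfl | ⟨q, f, rfl⟩
      · rw [← hlab] at h
        simp [GenSet.label] at h
      · rw [← hlab, GenSet.label_append] at h
        obtain ⟨h₁, h₂⟩ := List.append_inj' h rfl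
        refine (DirGraph.isReduced_snoc.1 hp.2.1).2 f (by simp) ?_
        have h₃ : f.2 = F.S.inv e.2 := by simpa [GenSet.label] using h₂
        obtain ⟨w, hw, hw'⟩ := DirGraph.isPath_append.1 hk.1
        have h₄ : f.1 * F.S.val f.2 = e.1 := hw'.2
        refine Prod.ext h₄.symm ?_
        show e.2 = F.S.inv f.2
        rw [h₃, F.S.inv_inv]

theorem exists_isReducedPath (hF : F.IsFlow ⊥) {y : List A} (hy : y ∈ F.N) :
    ∃ p, (tree hF).IsReducedPath 1 p (F.S.eval y) := by
  induction y using List.reverseRecOn with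
  | nil => exact ⟨[], rfl, List.isChain_nil, by simp⟩
  | append_singleton y a ih =>
    obtain ⟨p, hp⟩ := ih (hF.of_append y a hy)
    have he : (F.S.eval y, a) ∈ (tree hF).edges := by
      refine Or.inl ?_
      show F.nf (F.S.eval y) ++ [a] ∈ F.N
      rwa [hF.nf_eval (hF.of_append y a hy)]
    have ht : F.S.cayley.tgt (F.S.eval y, a) = F.S.eval (y ++ [a]) := by simp [GenSet.cayley]
    rw [← ht]
    rcases hp.extend he rfl with h | ⟨q, -, h⟩
    · exact ⟨_, h⟩
    · exact ⟨_, h⟩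

/-- Paths from 1 are unique since their labels are the normal forms. Uniqueness is then carried to
every other starting vertex along its normal form, one edge at a time. -/
theorem isSpanningTree_tree (hF : F.IsFlow ⊥) : (tree hF).IsSpanningTree := by
  refine ⟨rfl, ⟨1, Set.mem_univ _⟩, fun u _ v _ => ?_⟩
  rw [← hF.eval_nf u]
  have hu := hF.nf_mem u
  generalize F.nf u = w at hu ⊢
  induction w using List.reverseRecOn with
  | nil =>
    apply existsUnique_of_exists_of_unique
    · obtain ⟨p, hp⟩ := exists_isReducedPath hF (hF.nf_mem v)
      exact ⟨p, by rwa [hF.eval_nf] at hp⟩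
    · intro p q hp hq
      rw [(GenSet.eq_walk hp.1).1, (GenSet.eq_walk hq.1).1]
      simp only [GenSet.eval_nil] at hp hq ⊢
      rw [label_eq_nf hF hp, label_eq_nf hF hq]
  | append_singleton y a ih =>
    have hy := hF.of_append y a hu
    have he : (F.S.eval y, a) ∈ (tree hF).edges := by
      refine Or.inl ?_
      show F.nf (F.S.eval y) ++ [a] ∈ F.N
      rwa [hF.nf_eval hy]
    have ht : F.S.cayley.tgt (F.S.eval y, a) = F.S.eval (y ++ [a]) := by simp [GenSet.cayley]
    rw [← ht]
    exact DirGraph.Subgraph.existsUnique_of_edge he (ih hy)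

theorem normalForms_tree (hF : F.IsFlow ⊥) : F.S.normalForms (tree hF) = F.N := by
  ext y
  constructor
  · rintro ⟨p, g, hp, rfl⟩
    rw [label_eq_nf hF hp]
    exact hF.nf_mem g
  · intro hy
    obtain ⟨p, hp⟩ := exists_isReducedPath hF hy
    exact ⟨p, _, hp, by rw [label_eq_nf hF hp, hF.nf_eval hy]⟩

theorem exists_isFlowFunction (hF : F.IsFlow ⊥) :
    ∃ K, DirGraph.IsFlowFunction (tree hF) (fun e => F.S.walk e.1 (F.phi (F.nf e.1) e.2)) K := by
  obtain ⟨K, hK⟩ := hF.phi_bdd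
  refine ⟨K, isSpanningTree_tree hF, ?_, ?_, ?_, ?_⟩
  · rintro ⟨g, a⟩
    have := F.S.isPath_walk g (F.phi (F.nf g) a)
    rwa [hF.phi_eval _ (hF.nf_mem g)] at this
  · intro e
    rw [F.S.length_walk]
    exact hK _ (hF.nf_mem _) _
  · rintro ⟨g, a⟩ (h | ⟨y, h⟩)
    · simp only [] at h ⊢
      rw [hF.phi_up _ _ h]
      rfl
    · have hy : y ++ [F.S.inv a] ∈ F.N := h ▸ hF.nf_mem g
      have := hF.phi_down _ _ hy
      rw [F.S.inv_inv] at this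
      simp only [] at h ⊢
      rw [h, this]
      rfl
  · rintro ⟨s, hs⟩
    -- Letters of `B` would represent 1, so `B` is empty and every edge outside the tree is active.
    have hact : ∀ i, F.IsActive ⊥ (s i) := fun i =>
      ⟨(hs i).1, fun h => F.S.val_ne_one _ (hF.val_mem _ h.2)⟩
    have := wellFounded_iff_isEmpty_descending_chain.1 hF.wf
    exact this.false ⟨s, fun i => ⟨hact _, hact _, (hs i).2⟩⟩

theorem isSyncRegular_graph [Finite A] (hF : F.IsFlow ⊥) (hR : F.IsRegular) :
    IsSyncRegular (F.S.graph (tree hF) fun e => F.S.walk e.1 (F.phi (F.nf e.1) e.2)) := by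
  obtain ⟨K, hK⟩ := hF.phi_bdd
  rw [IsSyncRegular, ← reg_iff]
  have h : (padded '' F.S.graph (tree hF) fun e => F.S.walk e.1 (F.phi (F.nf e.1) e.2)) =
      ⋃ a : A, ⋃ u ∈ {u : List A | u.length ≤ K},
        padded '' {x | ∃ y ∈ {y | y ∈ F.N ∧ F.phi y a = u}, x = ![y, [a], u]} := by
    ext X
    simp only [Set.mem_image, Set.mem_iUnion, GenSet.graph, GenSet.label_walk,
      normalForms_tree hF]
    constructor
    · rintro ⟨_, ⟨y, hy, a, rfl⟩, rfl⟩
      refine ⟨a, F.phi y a, hK y hy a, _, ⟨y, ⟨hy, rfl⟩, ?_⟩, rfl⟩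
      rw [hF.nf_eval hy]
    · rintro ⟨a, u, -, _, ⟨y, ⟨hy, rfl⟩, rfl⟩, rfl⟩
      refine ⟨_, ⟨y, hy, a, rfl⟩, ?_⟩
      rw [hF.nf_eval hy]
  rw [h]
  exact Reg.iUnion fun a => Reg.biUnion (List.finite_length_le A K) fun u _ =>
    (hR.reg_phi a u).triple_image a u

/-- The letters may live in any universe, whereas stackability asks for letters in `Type`; hence the
renaming by `Fin n`. -/
theorem IsFlow.stackable [Finite A] (hF : F.IsFlow ⊥) : Stackable G := by
  obtain ⟨n, ⟨e⟩⟩ := Finite.exists_equiv_fin A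
  obtain ⟨K, hK⟩ := exists_isFlowFunction (hF.rename e)
  exact ⟨Fin n, inferInstance, _, _, _, K, hK⟩

theorem IsFlow.autostackable [Finite A] (hF : F.IsFlow ⊥) (hR : F.IsRegular) :
    Autostackable G := by
  obtain ⟨n, ⟨e⟩⟩ := Finite.exists_equiv_fin A
  obtain ⟨K, hK⟩ := exists_isFlowFunction (hF.rename e)
  exact ⟨Fin n, inferInstance, _, _, _, K, hK, isSyncRegular_graph _ (hR.rename e)⟩

end FlowData


/-! ### Trivialisation of a family of sets along a tree -/

section Trivialization

variable {V E : Type*} {Λ : EdgeGraph V E} {X : V → Type*}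
  (σ : ∀ d : E × Bool, X (Λ.toDirGraph.tgt d) ≃ X (Λ.toDirGraph.tgt (Λ.toDirGraph.bar d)))

/-- Transport along a path. -/
def transport : ∀ (p : List (E × Bool)) (u v : V), Λ.toDirGraph.IsPath u p v → (X v ≃ X u)
  | [], u, v, h => Equiv.cast (congrArg X (show u = v from h).symm)
  | d :: p, u, v, h => (transport p _ v h.2).trans ((σ d).trans (Equiv.cast (congrArg X
      (show Λ.toDirGraph.tgt (Λ.toDirGraph.bar d) = u from h.1))))

theorem transport_snoc (p : List (E × Bool)) (u : V) (d : E × Bool)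
    (h : Λ.toDirGraph.IsPath u p (Λ.toDirGraph.tgt (Λ.toDirGraph.bar d)))
    (h' : Λ.toDirGraph.IsPath u (p ++ [d]) (Λ.toDirGraph.tgt d)) (x : X (Λ.toDirGraph.tgt d)) :
    transport σ (p ++ [d]) u _ h' x = transport σ p u _ h (σ d x) := by
  induction p generalizing u with
  | nil =>
    obtain rfl : u = _ := h
    rfl
  | cons e p ih =>
    have := ih _ h.2 h'.2
    simp only [List.cons_append, transport, Equiv.trans_apply]
    rw [this]

theorem transport_congr {p q : List (E × Bool)} (hpq : p = q) {u v : V}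
    (h : Λ.toDirGraph.IsPath u p v) (h' : Λ.toDirGraph.IsPath u q v) :
    transport σ p u v h = transport σ q u v h' := by
  subst hpq
  rfl

/-- `θ v` is transport along the reduced tree path from `v₀` to `v`. For a tree edge, the path to
one end extends the path to the other, and `σ` on opposite edges is inverse. -/
theorem exists_trivialization {τ : Λ.toDirGraph.Subgraph} (hτ : τ.IsSpanningTree) (v₀ : V)
    (h₁ : ∀ e x, σ (e, false) (σ (e, true) x) = x)
    (h₂ : ∀ e x, σ (e, true) (σ (e, false) x) = x) :
    ∃ θ : ∀ v, X v ≃ X v₀, ∀ d ∈ τ.edges, ∀ x,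
      θ (Λ.toDirGraph.tgt (Λ.toDirGraph.bar d)) (σ d x) = θ (Λ.toDirGraph.tgt d) x := by
  have hex : ∀ v, ∃! p, τ.IsReducedPath v₀ p v := fun v =>
    hτ.2.2 v₀ (by simp [hτ.1]) v (by simp [hτ.1])
  choose p hp hu using hex
  refine ⟨fun v => transport σ (p v) v₀ v (hp v).1, fun d hd x => ?_⟩
  rcases (hp (Λ.toDirGraph.tgt (Λ.toDirGraph.bar d))).extend hd (DirGraph.tgt_bar d).symm with
    h | ⟨q, hq, h⟩
  · have := hu _ _ h
    rw [← transport_snoc σ _ _ _ _ h.1]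
    exact DFunLike.congr_fun (transport_congr σ this _ _) x
  · have hq' := hu _ _ h
    have hpp := (hp (Λ.toDirGraph.tgt (Λ.toDirGraph.bar d))).1
    have hpp' := hpp
    rw [hq] at hpp'
    have h₃ : transport σ (p (Λ.toDirGraph.tgt (Λ.toDirGraph.bar d))) v₀ _ hpp =
      transport σ (q ++ [Λ.toDirGraph.bar d]) v₀ _ hpp' := transport_congr σ hq _ _
    dsimp only
    rw [h₃]
    -- For a concrete Boolean, reversing the edge twice gives back the same edge by computation, so
    -- no cast arises.
    obtain ⟨e, _ | _⟩ := d
    · refine (transport_snoc σ q v₀ (e, true) h.1 hpp' _).trans ?_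
      refine (congrArg _ (h₂ e x)).trans ?_
      exact DFunLike.congr_fun (transport_congr σ hq' _ _) x
    · refine (transport_snoc σ q v₀ (e, false) h.1 hpp' _).trans ?_
      refine (congrArg _ (h₁ e x)).trans ?_
      exact DFunLike.congr_fun (transport_congr σ hq' _ _) x

end Trivialization

/-! ### Reduced sequences and the action of the fundamental group on them -/

section Reduced

variable {V E : Type*} {Λ : EdgeGraph V E} {𝒢 : GraphOfGroups Λ}
  {A : E × Bool → Type*}
  (F : ∀ d : E × Bool, FlowData (𝒢.vertexGroup (Λ.toDirGraph.tgt d)) (A d))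

/-- The sequences of edges and coset representatives that start at the given vertex and do not
backtrack. -/
def ValidFrom : V → List (Σ d, List (A d)) → Prop
  | _, [] => True
  | v, b :: L => Λ.toDirGraph.src b.1 = v ∧ b.2 ∈ (F b.1).N ∧
      (∀ c ∈ L.head?, c.1 = Λ.toDirGraph.bar b.1 → b.2 ≠ []) ∧ ValidFrom (Λ.toDirGraph.tgt b.1) L

/-- A reduced sequence in a graph of groups that starts at the vertex `v`. -/
@[ext]
structure RedSeq (v : V) where
  head : 𝒢.vertexGroup v
  tail : List (Σ d, List (A d))
  valid : ValidFrom F v tail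

variable {F} (hF : ∀ d, (F d).IsFlow (𝒢.hom d).range)

include hF in
theorem exists_hom_mul (d : E × Bool) (g : 𝒢.vertexGroup (Λ.toDirGraph.tgt d)) :
    ∃ k, g = 𝒢.hom d k * (F d).S.eval ((F d).nf g) := by
  obtain ⟨_, ⟨k, rfl⟩, hk⟩ := (hF d).nf_spec g
  exact ⟨k, hk⟩

include hF in
theorem nf_hom_mul (d : E × Bool) (k : 𝒢.edgeGroup d.1) {w : List (A d)} (hw : w ∈ (F d).N) :
    (F d).nf (𝒢.hom d k * (F d).S.eval w) = w :=
  (hF d).nf_mul _ ⟨k, rfl⟩ w hw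

/-- The component in the edge group. -/
noncomputable def coef (d : E × Bool) (g : 𝒢.vertexGroup (Λ.toDirGraph.tgt d)) :
    𝒢.edgeGroup d.1 :=
  (exists_hom_mul hF d g).choose

theorem hom_coef_mul (d : E × Bool) (g : 𝒢.vertexGroup (Λ.toDirGraph.tgt d)) :
    g = 𝒢.hom d (coef hF d g) * (F d).S.eval ((F d).nf g) :=
  (exists_hom_mul hF d g).choose_spec

theorem coef_hom_mul (d : E × Bool) (k : 𝒢.edgeGroup d.1) {w : List (A d)}
    (hw : w ∈ (F d).N) : coef hF d (𝒢.hom d k * (F d).S.eval w) = k := by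
  have := hom_coef_mul hF d (𝒢.hom d k * (F d).S.eval w)
  rw [nf_hom_mul hF d k hw] at this
  exact (𝒢.hom_injective d (mul_right_cancel this)).symm

open Classical in
/-- The map on reduced sequences given by an edge. -/
noncomputable def push (d : E × Bool) (x : RedSeq F (Λ.toDirGraph.tgt d)) :
    RedSeq F (Λ.toDirGraph.tgt (Λ.toDirGraph.bar d)) :=
  if h : (F d).nf x.head = [] ∧ ∃ w L, x.tail = ⟨Λ.toDirGraph.bar d, w⟩ :: L then
    ⟨𝒢.hom (Λ.toDirGraph.bar d) (coef hF d x.head) *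
        (F (Λ.toDirGraph.bar d)).S.eval h.2.choose, h.2.choose_spec.choose, by
      have := x.valid
      rw [h.2.choose_spec.choose_spec] at this
      exact this.2.2.2⟩
  else
    ⟨𝒢.hom (Λ.toDirGraph.bar d) (coef hF d x.head), ⟨d, (F d).nf x.head⟩ :: x.tail, by
      refine ⟨(DirGraph.tgt_bar d).symm, (hF d).nf_mem _, ?_, x.valid⟩
      intro c hc hcd hnf
      refine h ⟨hnf, ?_⟩
      rcases hx : x.tail with _ | ⟨⟨c', w⟩, L⟩
      · simp [hx] at hc
      · obtain rfl : ⟨c', w⟩ = c := by simpa [hx] using hc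
        obtain rfl : c' = _ := hcd
        exact ⟨w, L, rfl⟩⟩

/-- `push` is left multiplication by the edge `d`: the edge group part `k` passes to the other side,
and `d` with the representative `w` becomes the first entry of the tail. This form and
`push_cancel`, for opposite edges, undo each other. -/
theorem push_cons (d : E × Bool) (k : 𝒢.edgeGroup d.1) {w : List (A d)} (hw : w ∈ (F d).N)
    {L : List (Σ d, List (A d))} (hL : ValidFrom F (Λ.toDirGraph.tgt d) L)
    (hLw : ∀ c ∈ L.head?, c.1 = Λ.toDirGraph.bar d → w ≠ []) :
    push hF d ⟨𝒢.hom d k * (F d).S.eval w, L, hL⟩ =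
      ⟨𝒢.hom (Λ.toDirGraph.bar d) k, ⟨d, w⟩ :: L,
        (DirGraph.tgt_bar d).symm, hw, hLw, hL⟩ := by
  have : ¬ ((F d).nf (𝒢.hom d k * (F d).S.eval w) = [] ∧
      ∃ w L', L = ⟨Λ.toDirGraph.bar d, w⟩ :: L') := by
    rintro ⟨h₁, w', L', rfl⟩
    rw [nf_hom_mul hF d k hw] at h₁
    exact hLw _ rfl rfl h₁
  unfold push
  rw [dif_neg this]
  simp only [coef_hom_mul hF d k hw, nf_hom_mul hF d k hw]

theorem push_cancel (d : E × Bool) (k : 𝒢.edgeGroup d.1) {w : List (A (Λ.toDirGraph.bar d))}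
    {L : List (Σ d, List (A d))}
    (hL : ValidFrom F (Λ.toDirGraph.tgt d) (⟨Λ.toDirGraph.bar d, w⟩ :: L)) :
    push hF d ⟨𝒢.hom d k, ⟨Λ.toDirGraph.bar d, w⟩ :: L, hL⟩ =
      ⟨𝒢.hom (Λ.toDirGraph.bar d) k * (F (Λ.toDirGraph.bar d)).S.eval w, L, hL.2.2.2⟩ := by
  have hnf := nf_hom_mul hF d k (hF d).nil_mem
  have hco := coef_hom_mul hF d k (hF d).nil_mem
  rw [GenSet.eval_nil, mul_one] at hnf hco
  have : ((F d).nf (𝒢.hom d k) = [] ∧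
      ∃ w' L', (⟨Λ.toDirGraph.bar d, w⟩ :: L : List (Σ d, List (A d))) =
        ⟨Λ.toDirGraph.bar d, w'⟩ :: L') := ⟨hnf, w, L, rfl⟩
  unfold push
  rw [dif_pos this]
  have h₁ := this.2.choose_spec.choose_spec
  obtain ⟨h₂, h₃⟩ := List.cons.inj h₁
  have h₄ : this.2.choose = w := (eq_of_heq (Sigma.mk.inj h₂).2).symm
  ext1
  · simp only [hco]
    congr 2
  · exact h₃.symm

/-- Every reduced sequence is of one of the two forms on which `push` is given explicitly. -/
theorem redSeq_cases (hF : ∀ d, (F d).IsFlow (𝒢.hom d).range) (d : E × Bool)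
    (x : RedSeq F (Λ.toDirGraph.tgt d)) :
    (∃ k w L hL, w ∈ (F d).N ∧ (∀ c ∈ L.head?, c.1 = Λ.toDirGraph.bar d → w ≠ []) ∧
      x = ⟨𝒢.hom d k * (F d).S.eval w, L, hL⟩) ∨
    (∃ k w L hL, x = ⟨𝒢.hom d k, ⟨Λ.toDirGraph.bar d, w⟩ :: L, hL⟩) := by
  obtain ⟨g, L, hL⟩ := x
  obtain ⟨k, hk⟩ := exists_hom_mul hF d g
  by_cases h : ∀ c ∈ L.head?, c.1 = Λ.toDirGraph.bar d → (F d).nf g ≠ []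
  · exact Or.inl ⟨k, _, L, hL, (hF d).nf_mem g, h, by ext1; exacts [hk, rfl]⟩
  · push Not at h
    obtain ⟨⟨c, w⟩, hc, rfl, hg⟩ := h
    rcases L with _ | ⟨b, L⟩
    · simp at hc
    obtain rfl : b = _ := by simpa using hc
    rw [hg, GenSet.eval_nil, mul_one] at hk
    subst hk
    exact Or.inr ⟨k, w, L, hL, rfl⟩

theorem push_push_true (e : E) (x : RedSeq F (Λ.toDirGraph.tgt (e, true))) :
    push hF (e, false) (push hF (e, true) x) = x := by
  rcases redSeq_cases hF _ x with ⟨k, w, L, hL, hw, hLw, rfl⟩ | ⟨k, w, L, hL, rfl⟩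
  · rw [push_cons hF _ k hw hL hLw]
    exact push_cancel hF (e, false) k _
  · rw [push_cancel hF _ k hL]
    exact push_cons hF (e, false) k hL.2.1 _ hL.2.2.1

theorem push_push_false (e : E) (x : RedSeq F (Λ.toDirGraph.tgt (e, false))) :
    push hF (e, true) (push hF (e, false) x) = x := by
  rcases redSeq_cases hF _ x with ⟨k, w, L, hL, hw, hLw, rfl⟩ | ⟨k, w, L, hL, rfl⟩
  · rw [push_cons hF _ k hw hL hLw]
    exact push_cancel hF (e, true) k _
  · rw [push_cancel hF _ k hL]
    exact push_cons hF (e, true) k hL.2.1 _ hL.2.2.1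

/-- The bijection between sets of reduced sequences given by an edge. -/
noncomputable def pushEquiv : ∀ d : E × Bool, RedSeq F (Λ.toDirGraph.tgt d) ≃
    RedSeq F (Λ.toDirGraph.tgt (Λ.toDirGraph.bar d))
  | (e, true) => ⟨push hF (e, true), push hF (e, false), push_push_true hF e, push_push_false hF e⟩
  | (e, false) => ⟨push hF (e, false), push hF (e, true), push_push_false hF e, push_push_true hF e⟩

theorem pushEquiv_apply (d : E × Bool) (x : RedSeq F (Λ.toDirGraph.tgt d)) :
    pushEquiv hF d x = push hF d x := by
  obtain ⟨e, _ | _⟩ := d <;> rfl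

instance (v : V) : MulAction (𝒢.vertexGroup v) (RedSeq F v) where
  smul g x := ⟨g * x.head, x.tail, x.valid⟩
  one_smul _ := RedSeq.ext (one_mul _) rfl
  mul_smul _ _ _ := RedSeq.ext (mul_assoc _ _ _) rfl

theorem smul_mk {v : V} (g h : 𝒢.vertexGroup v) (L) (hL : ValidFrom F v L) :
    g • (⟨h, L, hL⟩ : RedSeq F v) = ⟨g * h, L, hL⟩ := rfl

/-- This is the relation of `edge_mul`, realised on reduced sequences; it makes the action of the
fundamental group well defined. -/
theorem push_smul (d : E × Bool) (k : 𝒢.edgeGroup d.1) (x : RedSeq F (Λ.toDirGraph.tgt d)) :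
    push hF d (𝒢.hom d k • x) = 𝒢.hom (Λ.toDirGraph.bar d) k • push hF d x := by
  rcases redSeq_cases hF _ x with ⟨l, w, L, hL, hw, hLw, rfl⟩ | ⟨l, w, L, hL, rfl⟩
  · rw [push_cons hF _ l hw hL hLw, smul_mk, ← mul_assoc]
    have := push_cons hF d (k * l) hw hL hLw
    rw [map_mul] at this
    exact this.trans (RedSeq.ext (map_mul (𝒢.hom (Λ.toDirGraph.bar d)) k l) rfl)
  · rw [push_cancel hF _ l hL, smul_mk]
    have := push_cancel hF d (k * l) hL
    rw [map_mul] at this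
    refine this.trans (RedSeq.ext ?_ rfl)
    exact (congrArg (· * _) (map_mul (𝒢.hom (Λ.toDirGraph.bar d)) k l)).trans (mul_assoc _ _ _)

end Reduced

/-! ### Elements of the fundamental group -/

namespace GraphOfGroups

variable {V E : Type*} {Λ : EdgeGraph V E} (𝒢 : GraphOfGroups Λ) (τ : Λ.toDirGraph.Subgraph)

/-- An element of a vertex group, in the fundamental group. -/
def vtx (v : V) : 𝒢.vertexGroup v →* 𝒢.FundamentalGroup τ :=
  (QuotientGroup.mk' _).comp (𝒢.ofVertex τ v)

open Classical in
/-- A directed edge, in the fundamental group. -/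
noncomputable def edge (d : E × Bool) : 𝒢.FundamentalGroup τ :=
  if h : d ∉ τ.edges then QuotientGroup.mk' _ (𝒢.ofEdge τ d h) else 1

variable {𝒢 τ}

theorem mk_eq_of_rel {x y : 𝒢.FreeProd τ} (h : 𝒢.Rel τ x y) :
    QuotientGroup.mk' (𝒢.relators τ) x = QuotientGroup.mk' (𝒢.relators τ) y := by
  rw [← mul_inv_eq_one, ← map_inv, ← map_mul]
  exact (QuotientGroup.eq_one_iff _).2 (Subgroup.subset_normalClosure ⟨x, y, h, rfl⟩)

theorem edge_of_mem {d : E × Bool} (hd : d ∈ τ.edges) : 𝒢.edge τ d = 1 := by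
  simp [edge, hd]

theorem edge_bar (d : E × Bool) : 𝒢.edge τ (Λ.toDirGraph.bar d) = (𝒢.edge τ d)⁻¹ := by
  by_cases hd : d ∈ τ.edges
  · rw [edge_of_mem hd, edge_of_mem (τ.bar_mem d hd), inv_one]
  · have hd' : Λ.toDirGraph.bar d ∉ τ.edges := fun h => hd (by
      simpa [Λ.toDirGraph.bar_bar] using τ.bar_mem _ h)
    rw [edge, edge, dif_pos hd, dif_pos hd', mk_eq_of_rel (Rel.bar d hd hd'), map_inv]

/-- Since tree edges represent 1, the amalgamation and conjugation relations take one common form.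
-/
theorem edge_mul (d : E × Bool) (g : 𝒢.edgeGroup d.1) :
    𝒢.edge τ d * 𝒢.vtx τ _ (𝒢.hom d g) = 𝒢.vtx τ _ (𝒢.hom (Λ.toDirGraph.bar d) g) * 𝒢.edge τ d := by
  by_cases hd : d ∈ τ.edges
  · rw [edge_of_mem hd, one_mul, mul_one]
    exact mk_eq_of_rel (Rel.tree d hd g)
  · rw [← mul_inv_eq_iff_eq_mul]
    rw [edge, dif_pos hd]
    exact mk_eq_of_rel (Rel.conj d hd g)

theorem fundamentalGroup_induction {P : 𝒢.FundamentalGroup τ → Prop} (one : P 1)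
    (vtx : ∀ g v k, P g → P (g * 𝒢.vtx τ v k)) (edge : ∀ g d, P g → P (g * 𝒢.edge τ d))
    (g : 𝒢.FundamentalGroup τ) : P g := by
  obtain ⟨x, rfl⟩ := QuotientGroup.mk'_surjective _ g
  suffices h : ∀ g, P g → P (g * QuotientGroup.mk' (𝒢.relators τ) x) by simpa using h 1 one
  induction x using Monoid.Coprod.induction_on with
  | inl x =>
    induction x using Monoid.CoprodI.induction_on with
    | one => intro g hg; simpa using hg
    | of v k => exact fun g hg => vtx g v k hg
    | mul x y hx hy => intro g hg; simpa [mul_assoc] using hy _ (hx g hg)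
  | inr x =>
    induction x using FreeGroup.induction_on with
    | C1 => intro g hg; simpa using hg
    | of d =>
      intro g hg
      have := edge g d.1 hg
      rwa [GraphOfGroups.edge, dif_pos d.2] at this
    | inv_of d _ =>
      intro g hg
      have := edge g (Λ.toDirGraph.bar d.1) hg
      rw [edge_bar, GraphOfGroups.edge, dif_pos d.2] at this
      rw [map_inv, map_inv]
      exact this
    | mul x y hx hy => intro g hg; simpa [mul_assoc] using hy _ (hx g hg)
  | mul x y hx hy => intro g hg; simpa [mul_assoc] using hy _ (hx g hg)

/-- Homomorphisms from the fundamental group. -/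
theorem exists_lift {P : Type*} [Group P] (f : ∀ v, 𝒢.vertexGroup v →* P) (s : E × Bool → P)
    (hbar : ∀ d, s (Λ.toDirGraph.bar d) = (s d)⁻¹) (hone : ∀ d ∈ τ.edges, s d = 1)
    (hmul : ∀ d g, s d * f _ (𝒢.hom d g) = f _ (𝒢.hom (Λ.toDirGraph.bar d) g) * s d) :
    ∃ ρ : 𝒢.FundamentalGroup τ →* P, (∀ v g, ρ (𝒢.vtx τ v g) = f v g) ∧
      ∀ d, ρ (𝒢.edge τ d) = s d := by
  let ρ₀ : 𝒢.FreeProd τ →* P :=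
    Monoid.Coprod.lift (Monoid.CoprodI.lift f) (FreeGroup.lift fun d => s d.1)
  have hv : ∀ v g, ρ₀ (𝒢.ofVertex τ v g) = f v g := fun v g => by simp [ρ₀, ofVertex]
  have he : ∀ d hd, ρ₀ (𝒢.ofEdge τ d hd) = s d := fun d hd => by simp [ρ₀, ofEdge]
  have hrel : 𝒢.relators τ ≤ ρ₀.ker := by
    refine Subgroup.normalClosure_le_normal ?_
    rintro _ ⟨x, y, h, rfl⟩
    show ρ₀ _ = 1
    rw [map_mul, map_inv, mul_inv_eq_one]
    cases h with
    | bar d hd hd' => rw [map_inv, he, he, hbar]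
    | tree d hd g =>
      rw [hv, hv]
      simpa [hone d hd] using hmul d g
    | conj d hd g => rw [map_mul, map_mul, map_inv, he, hv, hv, hmul, mul_inv_cancel_right]
  refine ⟨QuotientGroup.lift _ ρ₀ hrel, hv, fun d => ?_⟩
  by_cases hd : d ∈ τ.edges
  · rw [edge_of_mem hd, hone d hd, map_one]
  · rw [edge, dif_pos hd]
    exact he d hd

/-- A homomorphism to the integers kills the vertex groups and the tree edges, and sends the other
edges to 1 or -1 according to direction. -/
theorem edge_ne_one {d : E × Bool} (hd : d ∉ τ.edges) : 𝒢.edge τ d ≠ 1 := by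
  classical
  obtain ⟨ρ, -, hρ⟩ := exists_lift (𝒢 := 𝒢) (τ := τ) (P := Multiplicative ℤ) (fun _ => 1)
    (fun d => if d ∈ τ.edges then 1 else
      if d.2 then Multiplicative.ofAdd 1 else Multiplicative.ofAdd (-1)) (by
        intro d
        have : Λ.toDirGraph.bar d ∈ τ.edges ↔ d ∈ τ.edges :=
          ⟨fun h => by simpa [Λ.toDirGraph.bar_bar] using τ.bar_mem _ h, τ.bar_mem d⟩
        simp only [this]
        obtain ⟨e, _ | _⟩ := d <;> split_ifs <;> simp_all [EdgeGraph.toDirGraph])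
      (fun d hd => by simp [hd]) (fun d g => by simp)
  intro h
  have := hρ d
  rw [h, map_one, if_neg hd] at this
  obtain ⟨e, _ | _⟩ := d
  · exact absurd (show (1 : Multiplicative ℤ) = Multiplicative.ofAdd (-1) from this) (by decide)
  · exact absurd (show (1 : Multiplicative ℤ) = Multiplicative.ofAdd 1 from this) (by decide)

variable {A : E × Bool → Type*}
  {F : ∀ d : E × Bool, FlowData (𝒢.vertexGroup (Λ.toDirGraph.tgt d)) (A d)}

/-- The action of the fundamental group on reduced sequences, compatible with trivialisations. -/
theorem exists_action (hτ : τ.IsSpanningTree) (hF : ∀ d, (F d).IsFlow (𝒢.hom d).range) (v₀ : V) :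
    ∃ (θ : ∀ v, RedSeq F v ≃ RedSeq F v₀)
      (ρ : 𝒢.FundamentalGroup τ →* Equiv.Perm (RedSeq F v₀)),
      (∀ v g x, ρ (𝒢.vtx τ v g) (θ v x) = θ v (g • x)) ∧
      ∀ d x, ρ (𝒢.edge τ d) (θ (Λ.toDirGraph.tgt d) x) =
        θ (Λ.toDirGraph.tgt (Λ.toDirGraph.bar d)) (push hF d x) := by
  -- Identifying all sets of reduced sequences along the tree makes the tree edges act trivially, as
  -- the relations demand.
  obtain ⟨θ, hθ⟩ := exists_trivialization (pushEquiv hF) hτ v₀ (push_push_true hF)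
    (push_push_false hF)
  obtain ⟨ρ, h₁, h₂⟩ := exists_lift (𝒢 := 𝒢) (τ := τ) (P := Equiv.Perm (RedSeq F v₀))
    (fun v => ((θ v).permCongrHom.toMonoidHom).comp
      (MulAction.toPermHom (𝒢.vertexGroup v) (RedSeq F v)))
    (fun d => ((θ (Λ.toDirGraph.tgt d)).symm.trans (pushEquiv hF d)).trans
      (θ (Λ.toDirGraph.tgt (Λ.toDirGraph.bar d)))) (by
      intro d
      rw [eq_inv_iff_mul_eq_one]
      ext1 x
      obtain ⟨x, rfl⟩ := (θ (Λ.toDirGraph.tgt d)).surjective x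
      simp only [Equiv.Perm.mul_apply, Equiv.trans_apply, Equiv.symm_apply_apply,
        Equiv.Perm.one_apply]
      obtain ⟨e, _ | _⟩ := d
      · exact congrArg (θ _) (push_push_false hF e x)
      · exact congrArg (θ _) (push_push_true hF e x)) (by
      intro d hd
      ext1 x
      obtain ⟨x, rfl⟩ := (θ (Λ.toDirGraph.tgt d)).surjective x
      simp [hθ d hd]) (by
      intro d g
      ext1 x
      obtain ⟨x, rfl⟩ := (θ (Λ.toDirGraph.tgt d)).surjective x
      simp only [Equiv.Perm.mul_apply, Equiv.trans_apply, Equiv.symm_apply_apply,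
        MonoidHom.comp_apply, MulEquiv.toMonoidHom_eq_coe, MonoidHom.coe_coe,
        Equiv.permCongrHom_coe, Equiv.permCongr_apply, MulAction.toPermHom_apply,
        MulAction.toPerm_apply, pushEquiv_apply, push_smul])
  refine ⟨θ, ρ, fun v g x => ?_, fun d x => ?_⟩
  · rw [h₁]
    simp
  · rw [h₂]
    simp [pushEquiv_apply]

/-- An element of the vertex group can be read off from its action on the trivial sequence, whose
head it becomes. -/
theorem vtx_injective (hτ : τ.IsSpanningTree) (hF : ∀ d, (F d).IsFlow (𝒢.hom d).range) (v : V) :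
    Function.Injective (𝒢.vtx τ v) := by
  obtain ⟨θ, ρ, h, -⟩ := exists_action hτ hF v
  rw [injective_iff_map_eq_one]
  intro g hg
  have := h v g ⟨1, [], trivial⟩
  rw [hg, map_one, Equiv.Perm.one_apply] at this
  have : 1 = g * 1 := congrArg RedSeq.head ((θ v).injective this)
  simpa using this.symm

end GraphOfGroups


/-! ### Normal forms in the fundamental group -/

namespace GraphOfGroups

variable {V E : Type*} {Λ : EdgeGraph V E} {𝒢 : GraphOfGroups Λ} {τ : Λ.toDirGraph.Subgraph}
  {v₀ : V}

/-- The vertex at which a piece of a normal form lives: the base vertex for the initial piece, the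
end of the preceding edge for the others. -/
def vert (Λ : EdgeGraph V E) (v₀ : V) : Option (E × Bool) → V
  | none => v₀
  | some d => Λ.toDirGraph.tgt d

/-- The subgroup of the vertex group modulo which a piece of a normal form is determined. -/
def edgeSub (𝒢 : GraphOfGroups Λ) (v₀ : V) :
    ∀ j : Option (E × Bool), Subgroup (𝒢.vertexGroup (vert Λ v₀ j))
  | none => ⊥
  | some d => (𝒢.hom d).range

variable {A : Option (E × Bool) → Type*}
  (F : ∀ j : Option (E × Bool), FlowData (𝒢.vertexGroup (vert Λ v₀ j)) (A j))

/-- `IsFrame F j l` says that the pieces in `l`, followed by any piece of type `j`, form a reduced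
sequence. -/
inductive IsFrame : Option (E × Bool) → List (Σ j, List (A j)) → Prop
  | base : IsFrame none []
  | step {j : Option (E × Bool)} {l : List (Σ j, List (A j))} {w : List (A j)} {d : E × Bool} :
      IsFrame j l → w ∈ (F j).N → Λ.toDirGraph.tgt (Λ.toDirGraph.bar d) = vert Λ v₀ j →
      (j = some (Λ.toDirGraph.bar d) → w ≠ []) → IsFrame (some d) (l ++ [⟨j, w⟩])

variable (τ) in
/-- The element of the fundamental group given by the edge before a piece of type `j`. -/
noncomputable def edgeVal (𝒢 : GraphOfGroups Λ) : Option (E × Bool) → 𝒢.FundamentalGroup τ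
  | none => 1
  | some d => 𝒢.edge τ d

variable (τ) in
/-- The element of the fundamental group given by a sequence of pieces. -/
noncomputable def seqVal (m : List (Σ j, List (A j))) : 𝒢.FundamentalGroup τ :=
  (m.map fun b => edgeVal τ 𝒢 b.1 * 𝒢.vtx τ _ ((F b.1).S.eval b.2)).prod

theorem seqVal_snoc (l : List (Σ j, List (A j))) (j) (w : List (A j)) :
    seqVal τ F (l ++ [⟨j, w⟩]) =
      seqVal τ F l * edgeVal τ 𝒢 j * 𝒢.vtx τ _ ((F j).S.eval w) := by
  simp [seqVal, mul_assoc]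

theorem seqVal_snoc_nil (m : List (Σ j, List (A j))) (j) :
    seqVal τ F (m ++ [⟨j, []⟩]) = seqVal τ F m * edgeVal τ 𝒢 j := by
  simp [seqVal_snoc]

/-- The flow data of the pieces that follow an edge. -/
def edgeFlow (d : E × Bool) : FlowData (𝒢.vertexGroup (Λ.toDirGraph.tgt d)) (A (some d)) :=
  F (some d)

variable {F} (hτ : τ.IsSpanningTree) (hF : ∀ j, (F j).IsFlow (edgeSub 𝒢 v₀ j))

/-! ### Uniqueness of reduced sequences -/

section Unique

/-- Acting by a frame on a sequence that may follow it is mere concatenation. The induction moves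
the last piece of the frame to the front of `M`, where `push` never cancels. -/
theorem exists_redSeq (hF : ∀ j, (F j).IsFlow (edgeSub 𝒢 v₀ j))
    {θ : ∀ v, RedSeq (edgeFlow F) v ≃ RedSeq (edgeFlow F) v₀}
    {ρ : 𝒢.FundamentalGroup τ →* Equiv.Perm (RedSeq (edgeFlow F) v₀)}
    (h₁ : ∀ v g x, ρ (𝒢.vtx τ v g) (θ v x) = θ v (g • x))
    (h₂ : ∀ d x, ρ (𝒢.edge τ d) (θ (Λ.toDirGraph.tgt d) x) =
        θ (Λ.toDirGraph.tgt (Λ.toDirGraph.bar d)) (push (fun d => hF (some d)) d x))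
    {j : Option (E × Bool)} {l : List (Σ j, List (A j))} (hl : IsFrame F j l) :
    ∀ w ∈ (F j).N, ∀ (M : List (Σ d, List (A (some d))))
      (hM : ValidFrom (edgeFlow F) (vert Λ v₀ j) M),
      (∀ c ∈ M.head?, j = some (Λ.toDirGraph.bar c.1) → w ≠ []) →
      ∃ y : RedSeq (edgeFlow F) v₀,
        θ v₀ y = ρ (seqVal τ F l * edgeVal τ 𝒢 j) (θ (vert Λ v₀ j) ⟨(F j).S.eval w, M, hM⟩) ∧
        (⟨none, (F none).nf y.head⟩ :: y.tail.map fun b => (⟨some b.1, b.2⟩ : Σ j, List (A j))) =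
          l ++ ⟨j, w⟩ :: M.map fun b => (⟨some b.1, b.2⟩ : Σ j, List (A j)) := by
  induction hl with
  | base =>
    intro w hw M hM _
    refine ⟨⟨(F none).S.eval w, M, hM⟩, ?_, ?_⟩
    · simp [seqVal, edgeVal]
      rfl
    · simp [(hF none).nf_eval hw]
  | @step j l w d hl hw hd hjw ih =>
    intro w' hw' M hM hMw'
    have key : ∀ v (hv : Λ.toDirGraph.tgt (Λ.toDirGraph.bar d) = v), ∃ hM',
        ρ (𝒢.edge τ d) (θ (Λ.toDirGraph.tgt d) ⟨(F (some d)).S.eval w', M, hM⟩) =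
          θ v ⟨1, ⟨d, w'⟩ :: M, hM'⟩ := by
      rintro v rfl
      have hc : ∀ c ∈ M.head?, c.1 = Λ.toDirGraph.bar d → w' ≠ [] := by
        intro c hc hcd
        exact hMw' c hc (by rw [hcd, Λ.toDirGraph.bar_bar])
      have h := push_cons (fun d => hF (some d)) d 1 hw' hM hc
      rw [map_one, one_mul] at h
      refine ⟨⟨(DirGraph.tgt_bar d).symm, hw', hc, hM⟩, ?_⟩
      rw [h₂]
      refine congrArg (θ _) (h.trans (RedSeq.ext ?_ rfl))
      exact map_one (𝒢.hom (Λ.toDirGraph.bar d))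
    obtain ⟨hM', hk⟩ := key _ hd
    obtain ⟨y, hy₁, hy₂⟩ := ih w hw (⟨d, w'⟩ :: M) hM' (by
      intro c hc
      obtain rfl : ⟨d, w'⟩ = c := by simpa using hc
      exact hjw)
    refine ⟨y, ?_, ?_⟩
    · rw [hy₁, seqVal_snoc]
      simp only [map_mul, Equiv.Perm.mul_apply]
      have hk' : ρ (edgeVal τ 𝒢 (some d)) (θ (vert Λ v₀ (some d)) ⟨(F (some d)).S.eval w', M, hM⟩) =
        θ _ ⟨1, ⟨d, w'⟩ :: M, hM'⟩ := hk
      rw [hk', h₁, smul_mk, mul_one]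
    · simpa using hy₂

include hτ hF in
-- Both products act on the trivial sequence at the common end vertex, and the result spells out the
-- pieces. The end vertices must agree, since tree edges can be appended without changing the
-- element.
theorem IsFrame.unique {j j' : Option (E × Bool)} {l l' : List (Σ j, List (A j))}
    (hl : IsFrame F j l) (hl' : IsFrame F j' l') {w : List (A j)} {w' : List (A j')}
    (hw : w ∈ (F j).N) (hw' : w' ∈ (F j').N) (hv : vert Λ v₀ j = vert Λ v₀ j')
    (h : seqVal τ F (l ++ [⟨j, w⟩]) = seqVal τ F (l' ++ [⟨j', w'⟩])) :
    l ++ [⟨j, w⟩] = l' ++ [⟨j', w'⟩] := by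
  obtain ⟨θ, ρ, h₁, h₂⟩ := exists_action (F := edgeFlow F) hτ (fun d => hF (some d)) v₀
  obtain ⟨y, hy, hyl⟩ := exists_redSeq hF h₁ h₂ hl w hw [] trivial (by simp)
  obtain ⟨y', hy', hyl'⟩ := exists_redSeq hF h₁ h₂ hl' w' hw' [] trivial (by simp)
  have hone : ∀ v (g : 𝒢.vertexGroup v), θ v ⟨g, [], trivial⟩ =
      ρ (𝒢.vtx τ v g) (θ v ⟨1, [], trivial⟩) := fun v g => by
    rw [h₁]
    exact congrArg (θ v) (RedSeq.ext (mul_one g).symm rfl)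
  have hbase : ∀ v v' : V, v = v' → θ v ⟨1, [], trivial⟩ = θ v' ⟨1, [], trivial⟩ := by
    rintro v _ rfl
    rfl
  rw [hone, ← Equiv.Perm.mul_apply, ← map_mul, ← seqVal_snoc] at hy hy'
  rw [← h, hbase _ _ hv.symm, ← hy] at hy'
  obtain rfl := (θ v₀).injective hy'
  simpa using hyl.symm.trans hyl'

end Unique

include hF in
theorem nf_eq_nil_iff (j : Option (E × Bool)) (g : 𝒢.vertexGroup (vert Λ v₀ j)) :
    (F j).nf g = [] ↔ g ∈ edgeSub 𝒢 v₀ j := by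
  constructor
  · intro h
    obtain ⟨k, hk, hg⟩ := (hF j).nf_spec g
    rw [h, GenSet.eval_nil, mul_one] at hg
    rwa [hg]
  · intro h
    simpa using (hF j).nf_mul g h [] (hF j).nil_mem

theorem vtx_cast {v v' : V} (h : v = v') (k : 𝒢.vertexGroup v) :
    ∃ k' : 𝒢.vertexGroup v', 𝒢.vtx τ v' k' = 𝒢.vtx τ v k := by
  subst h
  exact ⟨k, rfl⟩

include hF in
/-- Frames can be multiplied on the right by the elements of the edge group. -/
theorem IsFrame.mul_edgeSub {j : Option (E × Bool)} {l : List (Σ j, List (A j))}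
    (hl : IsFrame F j l) : ∀ h ∈ edgeSub 𝒢 v₀ j, ∃ l', IsFrame F j l' ∧ l'.length = l.length ∧
      seqVal τ F l' * edgeVal τ 𝒢 j = seqVal τ F l * edgeVal τ 𝒢 j * 𝒢.vtx τ _ h := by
  induction hl with
  | base =>
    intro h hh
    obtain rfl := Subgroup.mem_bot.1 hh
    exact ⟨[], .base, rfl, by simp⟩
  | @step j l w d hl hw hd hjw ih =>
    rintro _ ⟨κ, rfl⟩
    -- The edge group element moves across `d` into the group of the preceding piece. If `d`
    -- reverses the edge before that piece, it must be known to stay in the edge subgroup, so that a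
    -- nonempty piece cannot become empty.
    obtain ⟨k, hk, hkj⟩ : ∃ k : 𝒢.vertexGroup (vert Λ v₀ j),
        𝒢.vtx τ _ k = 𝒢.vtx τ _ (𝒢.hom (Λ.toDirGraph.bar d) κ) ∧
        (j = some (Λ.toDirGraph.bar d) → k ∈ edgeSub 𝒢 v₀ j) := by
      by_cases hj : j = some (Λ.toDirGraph.bar d)
      · subst hj
        exact ⟨𝒢.hom (Λ.toDirGraph.bar d) κ, rfl, fun _ => ⟨κ, rfl⟩⟩
      · obtain ⟨k, hk⟩ := vtx_cast (τ := τ) hd (𝒢.hom (Λ.toDirGraph.bar d) κ)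
        exact ⟨k, hk, fun h => absurd h hj⟩
    obtain ⟨h, hh, hnf⟩ := (hF j).nf_spec ((F j).S.eval w * k)
    obtain ⟨l', hl', hlen, hval⟩ := ih h hh
    refine ⟨l' ++ [⟨j, (F j).nf ((F j).S.eval w * k)⟩], hl'.step ((hF j).nf_mem _) hd ?_,
      by simp [hlen], ?_⟩
    · intro hj hnil
      rw [nf_eq_nil_iff hF] at hnil
      refine hjw hj ?_
      have : (F j).S.eval w ∈ edgeSub 𝒢 v₀ j := by
        have := (edgeSub 𝒢 v₀ j).mul_mem hnil ((edgeSub 𝒢 v₀ j).inv_mem (hkj hj))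
        simpa using this
      rw [← nf_eq_nil_iff hF] at this
      rw [← this]
      simpa using ((hF j).nf_mul 1 (one_mem _) w hw).symm
    · rw [seqVal_snoc, seqVal_snoc, hval]
      have h₁ : 𝒢.vtx τ _ h * 𝒢.vtx τ _ ((F j).S.eval ((F j).nf ((F j).S.eval w * k))) =
          𝒢.vtx τ _ ((F j).S.eval w) * 𝒢.vtx τ _ k := by
        rw [← map_mul, ← hnf, map_mul]
      have h₂ := edge_mul (τ := τ) d κ
      calc _ = seqVal τ F l * edgeVal τ 𝒢 j * (𝒢.vtx τ _ h *
            𝒢.vtx τ _ ((F j).S.eval ((F j).nf ((F j).S.eval w * k)))) * 𝒢.edge τ d := by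
              simp only [mul_assoc, edgeVal]
        _ = seqVal τ F l * edgeVal τ 𝒢 j * 𝒢.vtx τ _ ((F j).S.eval w) *
            (𝒢.vtx τ _ (𝒢.hom (Λ.toDirGraph.bar d) κ) * 𝒢.edge τ d) := by
              rw [h₁, hk]
              simp only [mul_assoc]
        _ = _ := by
              rw [← h₂]
              simp only [mul_assoc, edgeVal]
              rfl

include hF in
-- The edge group part of `k` is absorbed by the frame and only its representative remains as last
-- piece. The preserved length is what the termination proof needs.
theorem IsFrame.mul {j : Option (E × Bool)} {l : List (Σ j, List (A j))} (hl : IsFrame F j l)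
    (k : 𝒢.vertexGroup (vert Λ v₀ j)) : ∃ l', IsFrame F j l' ∧ l'.length = l.length ∧
      seqVal τ F (l' ++ [⟨j, (F j).nf k⟩]) = seqVal τ F l * edgeVal τ 𝒢 j * 𝒢.vtx τ _ k := by
  obtain ⟨h, hh, hk⟩ := (hF j).nf_spec k
  obtain ⟨l', hl', hlen, hval⟩ := hl.mul_edgeSub (τ := τ) hF h hh
  refine ⟨l', hl', hlen, ?_⟩
  rw [seqVal_snoc, hval, mul_assoc, ← map_mul, ← hk]

/-! ### Words -/

variable (τ A) in
/-- The letters for the fundamental group: those of all pieces, and the edges outside the tree. -/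
abbrev Letter : Type _ := (Σ j, A j) ⊕ {d : E × Bool // d ∉ τ.edges}

open Classical in
variable (τ A) in
/-- The word for the edge before a piece. -/
noncomputable def edgeWord : Option (E × Bool) → List (Letter τ A)
  | none => []
  | some d => if h : d ∉ τ.edges then [Sum.inr ⟨d, h⟩] else []

variable (τ) in
/-- The word for a piece. -/
def embed (j : Option (E × Bool)) (w : List (A j)) : List (Letter τ A) :=
  w.map fun a => Sum.inl ⟨j, a⟩

variable (τ) in
/-- The word for a sequence of pieces. -/
noncomputable def seqWord (m : List (Σ j, List (A j))) : List (Letter τ A) :=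
  m.flatMap fun b => edgeWord τ A b.1 ++ embed τ b.1 b.2

theorem seqWord_snoc (l : List (Σ j, List (A j))) (j) (w : List (A j)) :
    seqWord τ (l ++ [⟨j, w⟩]) = seqWord τ l ++ edgeWord τ A j ++ embed τ j w := by
  simp [seqWord]

theorem seqWord_snoc_nil (m : List (Σ j, List (A j))) (j) :
    seqWord τ (m ++ [⟨j, []⟩]) = seqWord τ m ++ edgeWord τ A j := by
  simp [seqWord_snoc, embed]

theorem edgeWord_of_mem {d : E × Bool} (hd : d ∈ τ.edges) : edgeWord τ A (some d) = [] := by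
  simp [edgeWord, hd]

theorem edgeWord_of_notMem {d : E × Bool} (hd : d ∉ τ.edges) :
    edgeWord τ A (some d) = [Sum.inr ⟨d, hd⟩] := by
  simp [edgeWord, hd]

theorem bar_mem_iff {d : E × Bool} : Λ.toDirGraph.bar d ∈ τ.edges ↔ d ∈ τ.edges :=
  ⟨fun h => by simpa [Λ.toDirGraph.bar_bar] using τ.bar_mem _ h, τ.bar_mem d⟩

variable (F τ) in
/-- The element represented by a letter. -/
noncomputable def letterVal : Letter τ A → 𝒢.FundamentalGroup τ
  | Sum.inl ⟨j, a⟩ => 𝒢.vtx τ _ ((F j).S.val a)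
  | Sum.inr d => 𝒢.edge τ d.1

variable (F τ) in
/-- The element represented by a word. -/
noncomputable def wordVal (y : List (Letter τ A)) : 𝒢.FundamentalGroup τ :=
  (y.map (letterVal τ F)).prod

@[simp] theorem wordVal_nil : wordVal τ F [] = 1 := rfl

@[simp] theorem wordVal_append (x y : List (Letter τ A)) :
    wordVal τ F (x ++ y) = wordVal τ F x * wordVal τ F y := by
  simp [wordVal]

theorem wordVal_embed (j) (w : List (A j)) :
    wordVal τ F (embed τ j w) = 𝒢.vtx τ _ ((F j).S.eval w) := by
  induction w with
  | nil => simp [embed]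
  | cons a w ih =>
    rw [GenSet.eval_cons, map_mul, ← ih]
    rfl

theorem wordVal_edgeWord (j) : wordVal τ F (edgeWord τ A j) = edgeVal τ 𝒢 j := by
  rcases j with _ | d
  · rfl
  · by_cases hd : d ∈ τ.edges
    · rw [edgeWord_of_mem hd]
      exact (edge_of_mem hd).symm
    · rw [edgeWord_of_notMem hd]
      exact mul_one _

theorem wordVal_seqWord (m : List (Σ j, List (A j))) :
    wordVal τ F (seqWord τ m) = seqVal τ F m := by
  induction m using List.reverseRecOn with
  | nil => rfl
  | append_singleton m b ih =>
    obtain ⟨j, w⟩ := b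
    rw [seqWord_snoc, seqVal_snoc, wordVal_append, wordVal_append, ih, wordVal_embed,
      wordVal_edgeWord]

/-! ### Existence and uniqueness of normal forms -/

include hF in
/-- The normal form of the product with an edge. -/
theorem IsFrame.mul_edge {j : Option (E × Bool)} {l : List (Σ j, List (A j))} (hl : IsFrame F j l)
    {w : List (A j)} (hw : w ∈ (F j).N) (d : E × Bool)
    (hd : Λ.toDirGraph.tgt (Λ.toDirGraph.bar d) = vert Λ v₀ j) :
    ∃ j' l' w', IsFrame F j' l' ∧ w' ∈ (F j').N ∧ vert Λ v₀ j' = Λ.toDirGraph.tgt d ∧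
      seqVal τ F (l' ++ [⟨j', w'⟩]) = seqVal τ F (l ++ [⟨j, w⟩]) * 𝒢.edge τ d ∧
      (seqWord τ (l' ++ [⟨j', w'⟩]) = seqWord τ (l ++ [⟨j, w⟩]) ++ edgeWord τ A (some d) ∨
        seqWord τ (l ++ [⟨j, w⟩]) =
          seqWord τ (l' ++ [⟨j', w'⟩]) ++ edgeWord τ A (some (Λ.toDirGraph.bar d))) := by
  by_cases h : j = some (Λ.toDirGraph.bar d) → w ≠ []
  · refine ⟨some d, l ++ [⟨j, w⟩], [], hl.step hw hd h, (hF _).nil_mem, rfl, ?_, Or.inl ?_⟩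
    · rw [seqVal_snoc_nil]
      rfl
    · rw [seqWord_snoc_nil]
  · push Not at h
    obtain ⟨rfl, rfl⟩ := h
    generalize hb : Λ.toDirGraph.bar d = d' at *
    cases hl with
    | @step j' l' w' _ hl' hw' hd' hjw =>
      refine ⟨j', l', w', hl', hw', ?_, ?_, Or.inr ?_⟩
      · rw [← hd', ← hb, Λ.toDirGraph.bar_bar]
      · rw [seqVal_snoc_nil]
        show _ = _ * 𝒢.edge τ d' * _
        rw [← hb, edge_bar, inv_mul_cancel_right]
      · rw [seqWord_snoc_nil]

include hF in
-- Tree edges represent 1 and contribute no letters, so following them only appends or removes empty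
-- last pieces.
theorem IsFrame.move {u v : V} {p : List (E × Bool)} (hp : Λ.toDirGraph.IsPath u p v)
    (hpτ : ∀ d ∈ p, d ∈ τ.edges) :
    ∀ {j : Option (E × Bool)} {l : List (Σ j, List (A j))}, IsFrame F j l → ∀ {w : List (A j)},
      w ∈ (F j).N → vert Λ v₀ j = u →
    ∃ j' l' w', IsFrame F j' l' ∧ w' ∈ (F j').N ∧ vert Λ v₀ j' = v ∧
      seqVal τ F (l' ++ [⟨j', w'⟩]) = seqVal τ F (l ++ [⟨j, w⟩]) ∧
      seqWord τ (l' ++ [⟨j', w'⟩]) = seqWord τ (l ++ [⟨j, w⟩]) := by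
  induction p generalizing u with
  | nil =>
    obtain rfl : u = v := hp
    intro j l hl w hw hj
    exact ⟨j, l, w, hl, hw, hj, rfl, rfl⟩
  | cons d p ih =>
    intro j l hl w hw hj
    have hdτ := hpτ d (by simp)
    have hd : Λ.toDirGraph.tgt (Λ.toDirGraph.bar d) = vert Λ v₀ j := by
      rw [hj, DirGraph.tgt_bar]
      exact hp.1
    obtain ⟨j', l', w', hl', hw', hj', hval, hword⟩ := hl.mul_edge (τ := τ) hF hw d hd
    obtain ⟨j'', l'', w'', hl'', hw'', hj'', hval', hword'⟩ :=
      ih hp.2 (fun d hd => hpτ d (by simp [hd])) hl' hw' hj'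
    refine ⟨j'', l'', w'', hl'', hw'', hj'', ?_, ?_⟩
    · rw [hval', hval, edge_of_mem hdτ, mul_one]
    · rw [edgeWord_of_mem hdτ, edgeWord_of_mem (τ.bar_mem d hdτ), List.append_nil,
        List.append_nil] at hword
      rw [hword']
      rcases hword with h | h
      exacts [h, h.symm]

include hτ hF in
theorem IsFrame.moveTo {j : Option (E × Bool)} {l : List (Σ j, List (A j))} (hl : IsFrame F j l)
    {w : List (A j)} (hw : w ∈ (F j).N) (v : V) :
    ∃ j' l' w', IsFrame F j' l' ∧ w' ∈ (F j').N ∧ vert Λ v₀ j' = v ∧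
      seqVal τ F (l' ++ [⟨j', w'⟩]) = seqVal τ F (l ++ [⟨j, w⟩]) ∧
      seqWord τ (l' ++ [⟨j', w'⟩]) = seqWord τ (l ++ [⟨j, w⟩]) := by
  obtain ⟨p, hp, -⟩ := hτ.2.2 (vert Λ v₀ j) (by simp [hτ.1]) v (by simp [hτ.1])
  exact hl.move hF hp.1 hp.2.2 hw rfl

include hτ hF in
theorem exists_frame (g : 𝒢.FundamentalGroup τ) (v : V) :
    ∃ j l w, IsFrame F j l ∧ w ∈ (F j).N ∧ vert Λ v₀ j = v ∧ seqVal τ F (l ++ [⟨j, w⟩]) = g := by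
  suffices h : ∃ j l w, IsFrame F j l ∧ w ∈ (F j).N ∧ seqVal τ F (l ++ [⟨j, w⟩]) = g by
    obtain ⟨j, l, w, hl, hw, rfl⟩ := h
    obtain ⟨j', l', w', hl', hw', hj', hval, -⟩ := hl.moveTo hτ hF hw v
    exact ⟨j', l', w', hl', hw', hj', hval⟩
  induction g using fundamentalGroup_induction with
  | one => exact ⟨none, [], [], .base, (hF _).nil_mem, by simp [seqVal, edgeVal]⟩
  | vtx g v k ih =>
    obtain ⟨j, l, w, hl, hw, rfl⟩ := ih
    obtain ⟨j', l', w', hl', hw', hj', hval, -⟩ := hl.moveTo hτ hF hw v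
    subst hj'
    obtain ⟨l'', hl'', -, hval'⟩ := hl'.mul (τ := τ) hF ((F j').S.eval w' * k)
    refine ⟨j', l'', (F j').nf ((F j').S.eval w' * k), hl'', (hF j').nf_mem _, ?_⟩
    rw [hval', map_mul, ← mul_assoc, ← seqVal_snoc, hval]
  | edge g d ih =>
    obtain ⟨j, l, w, hl, hw, rfl⟩ := ih
    obtain ⟨j', l', w', hl', hw', hj', hval, -⟩ :=
      hl.moveTo hτ hF hw (Λ.toDirGraph.tgt (Λ.toDirGraph.bar d))
    obtain ⟨j'', l'', w'', hl'', hw'', -, hval', -⟩ := hl'.mul_edge (τ := τ) hF hw' d hj'.symm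
    exact ⟨j'', l'', w'', hl'', hw'', by rw [hval', hval]⟩

include hτ hF in
-- The end vertices can first be made equal by moving along the tree, which leaves the word
-- unchanged.
theorem IsFrame.seqWord_unique {j j' : Option (E × Bool)} {l l' : List (Σ j, List (A j))}
    (hl : IsFrame F j l) (hl' : IsFrame F j' l') {w : List (A j)} {w' : List (A j')}
    (hw : w ∈ (F j).N) (hw' : w' ∈ (F j').N)
    (h : seqVal τ F (l ++ [⟨j, w⟩]) = seqVal τ F (l' ++ [⟨j', w'⟩])) :
    seqWord τ (l ++ [⟨j, w⟩]) = seqWord τ (l' ++ [⟨j', w'⟩]) := by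
  obtain ⟨j₁, l₁, w₁, hl₁, hw₁, hj₁, hval, hword⟩ := hl.moveTo hτ hF hw (vert Λ v₀ j')
  rw [← hword, hl₁.unique hτ hF hl' hw₁ hw' hj₁ (hval.trans h)]

/-- Cutting off the last letter of a normal form. -/
theorem IsFrame.append_cases {j : Option (E × Bool)} {l : List (Σ j, List (A j))}
    (hl : IsFrame F j l) : ∀ {w : List (A j)}, w ∈ (F j).N → ∀ {y : List (Letter τ A)} {α},
      seqWord τ (l ++ [⟨j, w⟩]) = y ++ [α] →
    (∃ j' l' w' a, IsFrame F j' l' ∧ w' ++ [a] ∈ (F j').N ∧ α = Sum.inl ⟨j', a⟩ ∧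
      seqWord τ (l ++ [⟨j, w⟩]) = seqWord τ (l' ++ [⟨j', w' ++ [a]⟩]) ∧
      y = seqWord τ (l' ++ [⟨j', w'⟩])) ∨
    (∃ d j' l' w', IsFrame F j' l' ∧ w' ∈ (F j').N ∧ α = Sum.inr d ∧
      y = seqWord τ (l' ++ [⟨j', w'⟩])) := by
  have hword : ∀ {j : Option (E × Bool)} {l : List (Σ j, List (A j))} {w : List (A j)}
      {a : A j} {y : List (Letter τ A)} {α}, seqWord τ (l ++ [⟨j, w ++ [a]⟩]) = y ++ [α] →
      α = Sum.inl ⟨j, a⟩ ∧ y = seqWord τ (l ++ [⟨j, w⟩]) := by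
    intro j l w a y α h
    have h' : seqWord τ (l ++ [⟨j, w⟩]) ++ [Sum.inl ⟨j, a⟩] = y ++ [α] := by
      rw [← h, seqWord_snoc, seqWord_snoc]
      simp [embed]
    obtain ⟨h₁, h₂⟩ := List.append_inj' h' rfl
    exact ⟨by simpa using h₂.symm, h₁.symm⟩
  induction hl with
  | base =>
    intro w hw y α h
    rcases List.eq_nil_or_concat' w with rfl | ⟨w', a, rfl⟩
    · simp [seqWord, edgeWord, embed] at h
    · obtain ⟨rfl, rfl⟩ := hword h
      exact Or.inl ⟨_, _, w', a, .base, hw, rfl, rfl, rfl⟩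
  | @step j l w₁ d hl hw₁ hd hjw ih =>
    intro w hw y α h
    rcases List.eq_nil_or_concat' w with rfl | ⟨w', a, rfl⟩
    · rw [seqWord_snoc_nil] at h ⊢
      by_cases hdτ : d ∈ τ.edges
      · rw [edgeWord_of_mem hdτ, List.append_nil] at h ⊢
        exact ih hw₁ h
      · rw [edgeWord_of_notMem hdτ] at h
        obtain ⟨h₂, h₃⟩ := List.append_inj' h rfl
        exact Or.inr ⟨⟨d, hdτ⟩, j, l, w₁, hl, hw₁, by simpa using h₃.symm, h₂.symm⟩
    · obtain ⟨rfl, rfl⟩ := hword h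
      exact Or.inl ⟨_, _, w', a, hl.step hw₁ hd hjw, hw, rfl, rfl, rfl⟩

end GraphOfGroups


/-! ### The flow on the fundamental group -/

theorem GenSet.mem_walk_of_eq {G : Type*} [Group G] {A : Type*} (S : GenSet G A) (g : G)
    (u₁ : List A) (a : A) (u₂ : List A) :
    (g * S.eval u₁, a) ∈ S.walk g (u₁ ++ a :: u₂) := by
  rw [S.walk_append]
  exact List.mem_append_right _ (by simp [walk])

namespace GraphOfGroups

variable {V E : Type*} {Λ : EdgeGraph V E} {𝒢 : GraphOfGroups Λ} {τ : Λ.toDirGraph.Subgraph}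
  {v₀ : V} {A : Option (E × Bool) → Type*}
  {F : ∀ j : Option (E × Bool), FlowData (𝒢.vertexGroup (vert Λ v₀ j)) (A j)}

theorem embed_injective (j) : Function.Injective (embed (A := A) τ j) := by
  refine Function.Injective.list_map ?_
  intro a b h
  simpa using h

theorem notMem_B_none (hF : ∀ j, (F j).IsFlow (edgeSub 𝒢 v₀ j)) (a : A none) :
    a ∉ (F none).B := fun h =>
  (F none).S.val_ne_one a (Subgroup.mem_bot.1 ((hF none).val_mem a h))

variable (F) in
theorem exists_transWord (j' j : Option (E × Bool)) (a : A j) : ∃ u : List (A j'),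
    vert Λ v₀ j' = vert Λ v₀ j → 𝒢.vtx τ _ ((F j').S.eval u) = 𝒢.vtx τ _ ((F j).S.val a) := by
  by_cases h : vert Λ v₀ j' = vert Λ v₀ j
  · obtain ⟨k, hk⟩ := vtx_cast (τ := τ) h.symm ((F j).S.val a)
    obtain ⟨u, rfl⟩ := (F j').S.eval_surjective k
    exact ⟨u, fun _ => hk⟩
  · exact ⟨[], fun h' => absurd h' h⟩

variable (τ F) in
/-- A word over the letters of type `j'` for a letter of type `j`. -/
noncomputable def transWord (j' j : Option (E × Bool)) (a : A j) : List (A j') :=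
  (exists_transWord (τ := τ) F j' j a).choose

theorem vtx_transWord {j' j : Option (E × Bool)} (a : A j) (h : vert Λ v₀ j' = vert Λ v₀ j) :
    𝒢.vtx τ _ ((F j').S.eval (transWord τ F j' j a)) = 𝒢.vtx τ _ ((F j).S.val a) :=
  (exists_transWord (τ := τ) F j' j a).choose_spec h

/-- A letter of `B` represents the image of some `κ` in the edge group of `d`, which is the
conjugate by `d` of the image of `κ` on the other side. There is no such letter for the base piece,
whose subgroup is trivial. -/
theorem exists_parentWord (hF : ∀ j, (F j).IsFlow (edgeSub 𝒢 v₀ j)) (j : Option (E × Bool))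
    (a : A j) : ∃ y : List (Letter τ A), a ∈ (F j).B →
      wordVal τ F y = 𝒢.vtx τ _ ((F j).S.val a) ∧
      ∃ d, j = some d ∧ ∃ u : List (A (some (Λ.toDirGraph.bar d))),
        y = edgeWord τ A (some (Λ.toDirGraph.bar d)) ++
          (embed τ (some (Λ.toDirGraph.bar d)) u ++ edgeWord τ A (some d)) := by
  by_cases ha : a ∈ (F j).B
  · rcases j with _ | d
    · exact absurd ha (notMem_B_none hF a)
    · obtain ⟨κ, hκ⟩ := (hF (some d)).val_mem a ha
      obtain ⟨u, hu⟩ := (F (some (Λ.toDirGraph.bar d))).S.eval_surjective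
        (𝒢.hom (Λ.toDirGraph.bar d) κ)
      refine ⟨_, fun _ => ⟨?_, d, rfl, u, rfl⟩⟩
      rw [wordVal_append, wordVal_append, wordVal_edgeWord, wordVal_edgeWord, wordVal_embed, hu,
        ← hκ]
      show 𝒢.edge τ (Λ.toDirGraph.bar d) * (_ * 𝒢.edge τ d) = _
      rw [edge_bar, inv_mul_eq_iff_eq_mul]
      exact (edge_mul d κ).symm
  · exact ⟨[], fun h => absurd h ha⟩

/-- A word that leads through the preceding vertex group, for a letter in the edge group. -/
noncomputable def parentWord (hF : ∀ j, (F j).IsFlow (edgeSub 𝒢 v₀ j)) (τ : Λ.toDirGraph.Subgraph)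
    (j : Option (E × Bool)) (a : A j) : List (Letter τ A) :=
  (exists_parentWord (τ := τ) hF j a).choose

theorem parentWord_spec (hF : ∀ j, (F j).IsFlow (edgeSub 𝒢 v₀ j)) {j : Option (E × Bool)}
    {a : A j} (ha : a ∈ (F j).B) :
    wordVal τ F (parentWord hF τ j a) = 𝒢.vtx τ _ ((F j).S.val a) ∧
      ∃ d, j = some d ∧ ∃ u : List (A (some (Λ.toDirGraph.bar d))),
        parentWord hF τ j a = edgeWord τ A (some (Λ.toDirGraph.bar d)) ++
          (embed τ (some (Λ.toDirGraph.bar d)) u ++ edgeWord τ A (some d)) :=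
  (exists_parentWord (τ := τ) hF j a).choose_spec ha

open Classical in
/-- The label of the flow on an edge of the Cayley graph, in terms of the last piece of a normal
form of its initial vertex. -/
noncomputable def flowRule (hF : ∀ j, (F j).IsFlow (edgeSub 𝒢 v₀ j)) (τ : Λ.toDirGraph.Subgraph)
    (b : Σ j, List (A j)) (α : Σ j, A j) : List (Letter τ A) :=
  if h : α.1 = b.1 then
    if b.2 = [] ∧ (h ▸ α.2) ∈ (F b.1).B then parentWord hF τ α.1 α.2
    else embed τ b.1 ((F b.1).phi b.2 (h ▸ α.2))
  else embed τ b.1 (transWord τ F b.1 α.1 α.2)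

/-! ### Value and length of the flow labels -/

section Rule

variable (hF : ∀ j, (F j).IsFlow (edgeSub 𝒢 v₀ j))

theorem flowRule_parent {j : Option (E × Bool)} {w : List (A j)} {a : A j} (hw : w = [])
    (ha : a ∈ (F j).B) : flowRule hF τ ⟨j, w⟩ ⟨j, a⟩ = parentWord hF τ j a := by
  unfold flowRule
  rw [dif_pos rfl, if_pos ⟨hw, ha⟩]

theorem flowRule_phi {j : Option (E × Bool)} {w : List (A j)} {a : A j}
    (h : ¬ (w = [] ∧ a ∈ (F j).B)) :
    flowRule hF τ ⟨j, w⟩ ⟨j, a⟩ = embed τ j ((F j).phi w a) := by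
  unfold flowRule
  rw [dif_pos rfl, if_neg h]

theorem flowRule_of_ne {j' j : Option (E × Bool)} {w : List (A j')} {a : A j} (h : j' ≠ j) :
    flowRule hF τ ⟨j', w⟩ ⟨j, a⟩ = embed τ j' (transWord τ F j' j a) := by
  unfold flowRule
  rw [dif_neg (Ne.symm h)]

theorem wordVal_flowRule {j' j : Option (E × Bool)} (hj : vert Λ v₀ j' = vert Λ v₀ j)
    {w : List (A j')} (hw : w ∈ (F j').N) (a : A j) :
    wordVal τ F (flowRule hF τ ⟨j', w⟩ ⟨j, a⟩) = 𝒢.vtx τ _ ((F j).S.val a) := by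
  by_cases h : j' = j
  · subst h
    by_cases h' : w = [] ∧ a ∈ (F j').B
    · rw [flowRule_parent hF h'.1 h'.2]
      exact (parentWord_spec hF h'.2).1
    · rw [flowRule_phi hF h', wordVal_embed, (hF j').phi_eval w hw]
  · rw [flowRule_of_ne hF h, wordVal_embed, vtx_transWord a hj]

theorem flowRule_bdd [Finite E] [∀ j, Finite (A j)] : ∃ K, ∀ j, ∀ w ∈ (F j).N, ∀ α,
    (flowRule hF τ ⟨j, w⟩ α).length ≤ K := by
  choose K hK using fun j => (hF j).phi_bdd
  obtain ⟨K₁, hK₁⟩ := Finite.exists_le K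
  obtain ⟨K₂, hK₂⟩ := Finite.exists_le fun α : Σ j, A j => (parentWord hF τ α.1 α.2).length
  obtain ⟨K₃, hK₃⟩ := Finite.exists_le fun x : Option (E × Bool) × Σ j, A j =>
    (transWord τ F x.1 x.2.1 x.2.2).length
  refine ⟨K₁ + K₂ + K₃, ?_⟩
  rintro j' w hw ⟨j, a⟩
  by_cases h : j' = j
  · subst h
    by_cases h' : w = [] ∧ a ∈ (F j').B
    · rw [flowRule_parent hF h'.1 h'.2]
      have := hK₂ ⟨j', a⟩
      dsimp only at this
      omega
    · rw [flowRule_phi hF h', embed, List.length_map]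
      have := hK j' w hw a
      have := hK₁ j'
      omega
  · rw [flowRule_of_ne hF h, embed, List.length_map]
    have := hK₃ (j', ⟨j, a⟩)
    dsimp only at this
    omega

end Rule

/-! ### Generators, normal forms and termination of the flow -/

section Flow

variable (hτ : τ.IsSpanningTree) (hF : ∀ j, (F j).IsFlow (edgeSub 𝒢 v₀ j))

/-- The generating set of the fundamental group. -/
noncomputable def genSet : GenSet (𝒢.FundamentalGroup τ) (Letter τ A) where
  val := letterVal τ F
  inv
    | Sum.inl ⟨j, a⟩ => Sum.inl ⟨j, (F j).S.inv a⟩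
    | Sum.inr d => Sum.inr ⟨Λ.toDirGraph.bar d.1, fun h => d.2 (bar_mem_iff.1 h)⟩
  inv_inv := by
    rintro (⟨j, a⟩ | d)
    · exact congrArg (fun b => (Sum.inl ⟨j, b⟩ : Letter τ A)) ((F j).S.inv_inv a)
    · simp [Λ.toDirGraph.bar_bar]
  val_inv := by
    rintro (⟨j, a⟩ | d)
    · exact (congrArg (𝒢.vtx τ _) ((F j).S.val_inv a)).trans (map_inv _ _)
    · exact edge_bar _
  val_ne_one := by
    rintro (⟨j, a⟩ | d)
    · intro h
      refine (F j).S.val_ne_one a ?_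
      exact vtx_injective (F := edgeFlow F) hτ (fun d => hF (some d)) _ (h.trans (map_one _).symm)
    · exact edge_ne_one d.2
  closure_eq_top := by
    rw [eq_top_iff]
    rintro g -
    obtain ⟨j, l, w, -, -, -, rfl⟩ := exists_frame hτ hF g v₀
    rw [← wordVal_seqWord]
    refine Subgroup.list_prod_mem _ fun x hx => ?_
    obtain ⟨α, -, rfl⟩ := List.mem_map.1 hx
    exact Subgroup.subset_closure ⟨α, rfl⟩

/-- The normal form of an element of the fundamental group. -/
noncomputable def normalForm (g : 𝒢.FundamentalGroup τ) : List (Letter τ A) :=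
  let h := exists_frame hτ hF g v₀
  seqWord τ (h.choose_spec.choose ++ [⟨h.choose, h.choose_spec.choose_spec.choose⟩])

/-- The last piece of the reduced sequence for `g` that ends at the vertex `v`. -/
noncomputable def lastPiece (g : 𝒢.FundamentalGroup τ) (v : V) : Σ j, List (A j) :=
  let h := exists_frame hτ hF g v
  ⟨h.choose, h.choose_spec.choose_spec.choose⟩

theorem normalForm_eq {j : Option (E × Bool)} {l : List (Σ j, List (A j))} (hl : IsFrame F j l)
    {w : List (A j)} (hw : w ∈ (F j).N) :
    normalForm hτ hF (seqVal τ F (l ++ [⟨j, w⟩])) = seqWord τ (l ++ [⟨j, w⟩]) := by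
  have h := (exists_frame hτ hF (seqVal τ F (l ++ [⟨j, w⟩])) v₀).choose_spec.choose_spec.choose_spec
  exact h.1.seqWord_unique hτ hF hl h.2.1 hw h.2.2.2

theorem lastPiece_eq {j : Option (E × Bool)} {l : List (Σ j, List (A j))} (hl : IsFrame F j l)
    {w : List (A j)} (hw : w ∈ (F j).N) {v : V} (hv : vert Λ v₀ j = v) :
    lastPiece hτ hF (seqVal τ F (l ++ [⟨j, w⟩])) v = ⟨j, w⟩ := by
  have h := (exists_frame hτ hF (seqVal τ F (l ++ [⟨j, w⟩])) v).choose_spec.choose_spec.choose_spec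
  have := h.1.unique hτ hF hl h.2.1 hw (h.2.2.1.trans hv.symm) h.2.2.2
  exact List.singleton_injective (List.append_inj' this rfl).2

/-- The flow data for the fundamental group. -/
noncomputable def piFlow : FlowData (𝒢.FundamentalGroup τ) (Letter τ A) where
  S := genSet hτ hF
  B := ∅
  N := {y | ∃ j l w, IsFrame F j l ∧ w ∈ (F j).N ∧ y = seqWord τ (l ++ [⟨j, w⟩])}
  nf := normalForm hτ hF
  phi y
    | Sum.inl α => flowRule hF τ (lastPiece hτ hF (wordVal τ F y) (vert Λ v₀ α.1)) α
    | Sum.inr d => [Sum.inr d]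

theorem piFlow_eval (y : List (Letter τ A)) : (piFlow hτ hF).S.eval y = wordVal τ F y := rfl

theorem piFlow_phi_inl {j : Option (E × Bool)} {l : List (Σ j, List (A j))} (hl : IsFrame F j l)
    {w : List (A j)} (hw : w ∈ (F j).N) {y : List (Letter τ A)}
    (hy : wordVal τ F y = seqVal τ F (l ++ [⟨j, w⟩])) {α : Σ j, A j}
    (hv : vert Λ v₀ j = vert Λ v₀ α.1) :
    (piFlow hτ hF).phi y (Sum.inl α) = flowRule hF τ ⟨j, w⟩ α := by
  show flowRule hF τ (lastPiece hτ hF (wordVal τ F y) (vert Λ v₀ α.1)) α = _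
  rw [hy, lastPiece_eq hτ hF hl hw hv]

theorem wordVal_normalForm (g : 𝒢.FundamentalGroup τ) :
    wordVal τ F (normalForm hτ hF g) = g := by
  obtain ⟨j, l, w, hl, hw, -, rfl⟩ := exists_frame hτ hF g v₀
  rw [normalForm_eq hτ hF hl hw, wordVal_seqWord]

/-- Multiplying by the edge either appends its letter to the normal form or cancels the opposite
letter at the end; accordingly `piFlow` fixes these edges. -/
theorem isTreeEdge_inr (g : 𝒢.FundamentalGroup τ) (d) :
    (piFlow hτ hF).IsTreeEdge (g, Sum.inr d) := by
  obtain ⟨j, l, w, hl, hw, hj, rfl⟩ :=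
    exists_frame hτ hF g (Λ.toDirGraph.tgt (Λ.toDirGraph.bar d.1))
  obtain ⟨j', l', w', hl', hw', -, -, h⟩ := hl.mul_edge (τ := τ) hF hw d.1 hj.symm
  have hd' : Λ.toDirGraph.bar d.1 ∉ τ.edges := fun h => d.2 (bar_mem_iff.1 h)
  rw [edgeWord_of_notMem d.2, edgeWord_of_notMem hd'] at h
  rcases h with h | h
  · refine Or.inl ?_
    show normalForm hτ hF _ ++ [Sum.inr d] ∈ _
    rw [normalForm_eq hτ hF hl hw]
    exact ⟨j', l', w', hl', hw', h.symm⟩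
  · refine Or.inr ⟨seqWord τ (l' ++ [⟨j', w'⟩]), ?_⟩
    show normalForm hτ hF _ = _
    rw [normalForm_eq hτ hF hl hw, h]
    rfl

theorem seqWord_snoc_letter (l : List (Σ j, List (A j))) (j) (w : List (A j)) (a : A j) :
    seqWord τ (l ++ [⟨j, w ++ [a]⟩]) = seqWord τ (l ++ [⟨j, w⟩]) ++ [Sum.inl ⟨j, a⟩] := by
  rw [seqWord_snoc, seqWord_snoc]
  simp [embed]

theorem isTreeEdge_inl {j : Option (E × Bool)} {l : List (Σ j, List (A j))} (hl : IsFrame F j l)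
    {q : 𝒢.vertexGroup (vert Λ v₀ j)} {a : A j} (h : (F j).IsTreeEdge (q, a)) :
    (piFlow hτ hF).IsTreeEdge
      (seqVal τ F l * edgeVal τ 𝒢 j * 𝒢.vtx τ _ q, Sum.inl ⟨j, a⟩) := by
  obtain ⟨l', hl', -, hval⟩ := hl.mul (τ := τ) hF q
  have hnf : (piFlow hτ hF).nf (seqVal τ F l * edgeVal τ 𝒢 j * 𝒢.vtx τ _ q) =
      seqWord τ (l' ++ [⟨j, (F j).nf q⟩]) := by
    rw [← hval]
    exact normalForm_eq hτ hF hl' ((hF j).nf_mem q)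
  unfold FlowData.IsTreeEdge at h ⊢
  simp only [hnf] at h ⊢
  rcases h with h | ⟨y, h⟩
  · exact Or.inl ⟨j, l', _, hl', h, (seqWord_snoc_letter _ _ _ _).symm⟩
  · rw [h]
    exact Or.inr ⟨_, seqWord_snoc_letter _ _ _ _⟩

theorem mem_walk_embed {g : 𝒢.FundamentalGroup τ} {j : Option (E × Bool)} {u : List (A j)}
    {e : 𝒢.FundamentalGroup τ × Letter τ A}
    (h : e ∈ (piFlow hτ hF).S.walk g (embed τ j u)) :
    ∃ u₁ a u₂, u = u₁ ++ a :: u₂ ∧ e = (g * 𝒢.vtx τ _ ((F j).S.eval u₁), Sum.inl ⟨j, a⟩) := by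
  obtain ⟨y₁, y₂, h₁, h₂⟩ := GenSet.mem_walk h
  obtain ⟨u₁, u', rfl, rfl, h₃⟩ := List.map_eq_append_iff.1 h₁
  obtain ⟨a, u₂, rfl, h₄, -⟩ := List.map_eq_cons_iff.1 h₃
  refine ⟨u₁, a, u₂, rfl, Prod.ext ?_ h₄.symm⟩
  rw [h₂, piFlow_eval]
  exact congrArg _ (wordVal_embed _ _)

/-- The flow from an edge with a letter in the edge group leads to the preceding vertex group. -/
theorem acc_parent {j : Option (E × Bool)} {l : List (Σ j, List (A j))} (hl : IsFrame F j l)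
    (ih : ∀ m < l.length, ∀ j l, IsFrame F j l → l.length = m →
      ∀ (q : 𝒢.vertexGroup (vert Λ v₀ j)) (α : Σ j, A j), vert Λ v₀ j = vert Λ v₀ α.1 →
      Acc ((piFlow hτ hF).Step ⊥) (seqVal τ F l * edgeVal τ 𝒢 j * 𝒢.vtx τ _ q, Sum.inl α))
    {q : 𝒢.vertexGroup (vert Λ v₀ j)} {a : A j} (hq : (F j).nf q = []) (ha : a ∈ (F j).B) :
    Acc ((piFlow hτ hF).Step ⊥)
      (seqVal τ F l * edgeVal τ 𝒢 j * 𝒢.vtx τ _ q, Sum.inl ⟨j, a⟩) := by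
  obtain ⟨l', hl', hlen, hval⟩ := hl.mul (τ := τ) hF q
  refine Acc.intro _ fun e he => ?_
  obtain ⟨he', -, hmem⟩ := he
  rw [piFlow_phi_inl hτ hF hl' ((hF j).nf_mem q) (by rw [hval]; exact wordVal_normalForm hτ hF _)
    rfl, flowRule_parent hF hq ha] at hmem
  obtain ⟨-, d, rfl, u, hu⟩ := parentWord_spec (τ := τ) hF ha
  rw [hu, GenSet.walk_append, GenSet.walk_append] at hmem
  have hedge : ∀ (g : 𝒢.FundamentalGroup τ) d', e ∉ (piFlow hτ hF).S.walk g
      (edgeWord τ A (some d')) := by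
    intro g d' h
    by_cases hd : d' ∈ τ.edges
    · rw [edgeWord_of_mem hd] at h
      simp [GenSet.walk] at h
    · rw [edgeWord_of_notMem hd] at h
      obtain rfl := List.mem_singleton.1 h
      exact he'.1 (isTreeEdge_inr hτ hF _ _)
  rcases List.mem_append.1 hmem with h | h
  · exact absurd h (hedge _ _)
  rcases List.mem_append.1 h with h | h
  swap
  · exact absurd h (hedge _ _)
  obtain ⟨u₁, a', u₂, -, rfl⟩ := mem_walk_embed hτ hF h
  cases hl' with
  | @step j₁ l₁ w₁ _ hl₁ hw₁ hd hjw =>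
    obtain ⟨k, hk⟩ := vtx_cast (τ := τ) hd ((F (some (Λ.toDirGraph.bar d))).S.eval u₁)
    have := ih l₁.length (by rw [← hlen]; simp) j₁ l₁ hl₁ rfl ((F j₁).S.eval w₁ * k)
      ⟨some (Λ.toDirGraph.bar d), a'⟩ hd.symm
    convert this using 2
    rw [← hval, hq, seqVal_snoc_nil, seqVal_snoc, piFlow_eval, wordVal_edgeWord, map_mul, hk]
    show _ * 𝒢.edge τ d * 𝒢.edge τ (Λ.toDirGraph.bar d) * _ = _
    rw [edge_bar, mul_inv_cancel_right, mul_assoc]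
    rfl

/-- The flow within a translate of a vertex group. -/
theorem acc_same {j : Option (E × Bool)} {l : List (Σ j, List (A j))} (hl : IsFrame F j l)
    (ih : ∀ m < l.length, ∀ j l, IsFrame F j l → l.length = m →
      ∀ (q : 𝒢.vertexGroup (vert Λ v₀ j)) (α : Σ j, A j), vert Λ v₀ j = vert Λ v₀ α.1 →
      Acc ((piFlow hτ hF).Step ⊥) (seqVal τ F l * edgeVal τ 𝒢 j * 𝒢.vtx τ _ q, Sum.inl α))
    (x : 𝒢.vertexGroup (vert Λ v₀ j) × A j) :
    Acc ((piFlow hτ hF).Step ⊥)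
      (seqVal τ F l * edgeVal τ 𝒢 j * 𝒢.vtx τ _ x.1, Sum.inl ⟨j, x.2⟩) := by
  induction x using (hF j).wf.induction with
  | _ x hx =>
    obtain ⟨q, a⟩ := x
    by_cases hB : (F j).nf q = [] ∧ a ∈ (F j).B
    · exact acc_parent hτ hF hl ih hB.1 hB.2
    obtain ⟨l', hl', -, hval⟩ := hl.mul (τ := τ) hF q
    refine Acc.intro _ fun e he => ?_
    obtain ⟨he₁, he₂, hmem⟩ := he
    rw [piFlow_phi_inl hτ hF hl' ((hF j).nf_mem q)
      (by rw [hval]; exact wordVal_normalForm hτ hF _) rfl, flowRule_phi hF hB] at hmem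
    obtain ⟨u₁, a', u₂, hu, rfl⟩ := mem_walk_embed hτ hF hmem
    dsimp only at he₁ he₂ ⊢
    rw [mul_assoc, ← map_mul] at he₁ ⊢
    -- Edges in the Cayley graph of the edge subgroup leave this level through `acc_parent`; the
    -- other ones are steps of the well-founded flow of `F j`.
    by_cases hB' : q * (F j).S.eval u₁ ∈ edgeSub 𝒢 v₀ j ∧ a' ∈ (F j).B
    · exact acc_parent hτ hF hl ih ((nf_eq_nil_iff hF _ _).2 hB'.1) hB'.2
    refine hx (q * (F j).S.eval u₁, a') ⟨⟨fun h => ?_, hB'⟩, ⟨fun h => ?_, ?_⟩, ?_⟩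
    · exact he₁.1 (isTreeEdge_inl hτ hF hl h)
    · exact he₂.1 (isTreeEdge_inl hτ hF hl h)
    · rwa [← nf_eq_nil_iff hF]
    · rw [hu]
      exact (F j).S.mem_walk_of_eq q u₁ a' u₂

/-- The outer induction is on the number of pieces in the frame. A letter of another type is
respelled once in letters of type `j`, after which `acc_same` applies. -/
theorem acc_of_frame (n : ℕ) : ∀ (j : Option (E × Bool)) (l : List (Σ j, List (A j))),
    IsFrame F j l → l.length = n → ∀ (q : 𝒢.vertexGroup (vert Λ v₀ j)) (α : Σ j, A j), vert Λ v₀ j = vert Λ v₀ α.1 →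
      Acc ((piFlow hτ hF).Step ⊥)
        (seqVal τ F l * edgeVal τ 𝒢 j * 𝒢.vtx τ _ q, Sum.inl α) := by
  induction n using Nat.strong_induction_on with
  | _ n ih =>
    rintro j l hl rfl q ⟨j', a⟩ hj
    by_cases h : j = j'
    · subst h
      exact acc_same hτ hF hl ih (q, a)
    obtain ⟨l', hl', -, hval⟩ := hl.mul (τ := τ) hF q
    refine Acc.intro _ fun e he => ?_
    obtain ⟨-, -, hmem⟩ := he
    rw [piFlow_phi_inl hτ hF hl' ((hF j).nf_mem q)
      (by rw [hval]; exact wordVal_normalForm hτ hF _) hj, flowRule_of_ne hF h] at hmem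
    obtain ⟨u₁, a', u₂, hu, rfl⟩ := mem_walk_embed hτ hF hmem
    dsimp only
    rw [mul_assoc, ← map_mul]
    exact acc_same hτ hF hl ih (_, a')

theorem piFlow_isFlow [Finite E] [∀ j, Finite (A j)] : (piFlow hτ hF).IsFlow ⊥ := by
  have hcut : ∀ y α, y ++ [α] ∈ (piFlow hτ hF).N →
      (∃ j l w a, IsFrame F j l ∧ w ++ [a] ∈ (F j).N ∧ α = Sum.inl ⟨j, a⟩ ∧
        y ++ [α] = seqWord τ (l ++ [⟨j, w ++ [a]⟩]) ∧ y = seqWord τ (l ++ [⟨j, w⟩])) ∨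
      ∃ d j l w, IsFrame F j l ∧ w ∈ (F j).N ∧ α = Sum.inr d ∧
        y = seqWord τ (l ++ [⟨j, w⟩]) := by
    rintro y α ⟨j, l, w, hl, hw, h⟩
    rcases hl.append_cases hw h.symm with ⟨j', l', w', a, h₁, h₂, h₃, h₄, h₅⟩ | h'
    · exact Or.inl ⟨j', l', w', a, h₁, h₂, h₃, h.trans h₄, h₅⟩
    · exact Or.inr h'
  constructor
  · exact fun b hb => absurd hb (Set.notMem_empty b)
  · exact ⟨none, [], [], .base, (hF none).nil_mem, by simp [seqWord, edgeWord, embed]⟩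
  · intro y α h
    rcases hcut y α h with ⟨j, l, w, a, hl, hw, -, -, rfl⟩ | ⟨d, j, l, w, hl, hw, -, rfl⟩
    · exact ⟨j, l, w, hl, (hF j).of_append w a hw, rfl⟩
    · exact ⟨j, l, w, hl, hw, rfl⟩
  · exact fun b _ => Set.notMem_empty b
  · intro g
    obtain ⟨j, l, w, hl, hw, -, rfl⟩ := exists_frame hτ hF g v₀
    exact ⟨j, l, w, hl, hw, normalForm_eq hτ hF hl hw⟩
  · intro g
    refine ⟨1, one_mem _, ?_⟩
    rw [one_mul]
    exact (wordVal_normalForm hτ hF g).symm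
  · rintro h hh _ ⟨j, l, w, hl, hw, rfl⟩
    rw [Subgroup.mem_bot.1 hh, one_mul, piFlow_eval, wordVal_seqWord]
    exact normalForm_eq hτ hF hl hw
  · rintro y - (⟨j, a⟩ | d)
    · obtain ⟨j', l, w, hl, hw, hj, hval⟩ := exists_frame hτ hF (wordVal τ F y) (vert Λ v₀ j)
      rw [piFlow_phi_inl hτ hF hl hw hval.symm hj]
      exact wordVal_flowRule hF hj hw a
    · exact mul_one _
  · obtain ⟨K, hK⟩ := flowRule_bdd (τ := τ) hF
    refine ⟨K + 1, ?_⟩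
    rintro y - (α | d)
    · obtain ⟨j', l, w, hl, hw, hj, hval⟩ := exists_frame hτ hF (wordVal τ F y) (vert Λ v₀ α.1)
      rw [piFlow_phi_inl hτ hF hl hw hval.symm hj]
      have := hK j' w hw α
      omega
    · simp [piFlow]
  · intro y α h
    rcases hcut y α h with ⟨j, l, w, a, hl, hw, rfl, -, rfl⟩ | ⟨d, j, l, w, hl, hw, rfl, rfl⟩
    · rw [piFlow_phi_inl hτ hF hl ((hF j).of_append w a hw) (wordVal_seqWord _) rfl, flowRule_phi,
        (hF j).phi_up w a hw]
      · rfl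
      -- No normal form begins with a letter of `B`, so the detour through the preceding vertex
      -- group never replaces an upward tree edge.
      · rintro ⟨rfl, ha⟩
        exact (hF j).notMem_B a hw ha
    · rfl
  · intro y α h
    rcases hcut y α h with ⟨j, l, w, a, hl, hw, rfl, hya, rfl⟩ | ⟨d, j, l, w, hl, hw, rfl, rfl⟩
    · rw [hya]
      show (piFlow hτ hF).phi _ (Sum.inl ⟨j, (F j).S.inv a⟩) = _
      rw [piFlow_phi_inl hτ hF hl hw (wordVal_seqWord _) rfl, flowRule_phi _ (by simp),
        (hF j).phi_down w a hw]
      rfl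
    · rfl
  · refine ⟨fun e => ?_⟩
    by_cases he : (piFlow hτ hF).IsActive ⊥ e
    · obtain ⟨g, α | d⟩ := e
      · obtain ⟨j, l, w, hl, hw, hj, rfl⟩ := exists_frame hτ hF g (vert Λ v₀ α.1)
        rw [seqVal_snoc]
        exact acc_of_frame hτ hF _ j l hl rfl _ α hj
      · exact absurd (isTreeEdge_inr hτ hF g d) he.1
    · exact Acc.intro _ fun e' h => absurd h.2.1 he

end Flow

/-! ### Regularity -/

section Regularity

variable (F τ) in
/-- The words that are read between the beginnings of two consecutive pieces. -/
def pieceLang (j k : Option (E × Bool)) : Set (List (Letter τ A)) :=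
  {y | ∃ d w, k = some d ∧ w ∈ (F j).N ∧ Λ.toDirGraph.tgt (Λ.toDirGraph.bar d) = vert Λ v₀ j ∧
    (j = some (Λ.toDirGraph.bar d) → w ≠ []) ∧ y = embed τ j w ++ edgeWord τ A (some d)}

/-- Whether a frame can be extended depends only on its type and its next piece, so frames are walks
on the finite set of types. -/
theorem walks_pieceLang (j : Option (E × Bool)) (y : List (Letter τ A)) :
    Walks (pieceLang τ F) none j y ↔ ∃ l, IsFrame F j l ∧ y = seqWord τ l ++ edgeWord τ A j := by
  constructor
  · intro h
    induction h with
    | nil => exact ⟨[], .base, rfl⟩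
    | @snoc j k x z hx hz ih =>
      obtain ⟨l, hl, rfl⟩ := ih
      obtain ⟨d, w, rfl, hw, hd, hjw, rfl⟩ := hz
      refine ⟨l ++ [⟨j, w⟩], hl.step hw hd hjw, ?_⟩
      rw [seqWord_snoc]
      simp
  · rintro ⟨l, hl, rfl⟩
    induction hl with
    | base => exact .nil
    | @step j l w d hl hw hd hjw ih =>
      have := ih.snoc (k := some d) ⟨d, w, rfl, hw, hd, hjw, rfl⟩
      rw [seqWord_snoc]
      simpa using this

variable (hR : ∀ j, (F j).IsRegular)
include hR

theorem reg_pieceLang (j k : Option (E × Bool)) : Reg (pieceLang τ F j k) := by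
  rcases k with _ | d
  · convert Reg.empty using 1
    refine Set.eq_empty_of_forall_notMem ?_
    rintro y ⟨d, w, h, -⟩
    simp at h
  · have h₁ : Reg {w : List (A j) | w = [] ∧ j = some (Λ.toDirGraph.bar d)} :=
      Reg.of_finite ((Set.finite_singleton []).subset fun w hw => hw.1)
    have h₂ := (((hR j).reg_N.inter h₁.compl).and_const
      (Λ.toDirGraph.tgt (Λ.toDirGraph.bar d) = vert Λ v₀ j)).image_map
        (f := fun a => (Sum.inl ⟨j, a⟩ : Letter τ A)) (fun a b h => by simpa using h)
    convert h₂.mul (Reg.of_finite (Set.finite_singleton (edgeWord τ A (some d)))) using 1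
    ext y
    constructor
    · rintro ⟨_, w, ⟨rfl⟩, hw, hd, hjw, rfl⟩
      exact ⟨_, ⟨w, ⟨⟨hw, fun h => hjw h.2 h.1⟩, hd⟩, rfl⟩, _, rfl, rfl⟩
    · rintro ⟨_, ⟨w, ⟨⟨hw, hjw⟩, hd⟩, rfl⟩, _, rfl, rfl⟩
      exact ⟨d, w, rfl, hw, hd, fun h h' => hjw ⟨h', h⟩, rfl⟩

theorem reg_lastPiece [Finite E] (j : Option (E × Bool)) {P : Set (List (A j))} (hP : Reg P) :
    Reg {y : List (Letter τ A) | ∃ l w, IsFrame F j l ∧ w ∈ P ∧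
      y = seqWord τ (l ++ [⟨j, w⟩])} := by
  have h := (Reg.walks (reg_pieceLang (τ := τ) hR) none j).mul
    (hP.image_map (f := fun a => (Sum.inl ⟨j, a⟩ : Letter τ A)) (fun a b h => by simpa using h))
  convert h using 1
  ext y
  constructor
  · rintro ⟨l, w, hl, hw, rfl⟩
    exact ⟨_, (walks_pieceLang _ _).2 ⟨l, hl, rfl⟩, _, ⟨w, hw, rfl⟩, (seqWord_snoc _ _ _).symm⟩
  · rintro ⟨x, hx, _, ⟨w, hw, rfl⟩, rfl⟩
    obtain ⟨l, hl, rfl⟩ := (walks_pieceLang _ _).1 hx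
    exact ⟨l, w, hl, hw, (seqWord_snoc _ _ _).symm⟩

/-- The detour concerns at most the empty word; elsewhere the rule is a recoding of `phi` or
constant in `w`. -/
theorem reg_flowRule (hF : ∀ j, (F j).IsFlow (edgeSub 𝒢 v₀ j)) (j' : Option (E × Bool))
    (α : Σ j, A j) (u : List (Letter τ A)) :
    Reg {w | w ∈ (F j').N ∧ flowRule hF τ ⟨j', w⟩ α = u} := by
  obtain ⟨j, a⟩ := α
  by_cases h : j' = j
  · subst h
    have h₁ : Reg {w : List (A j') | w = [] ∧ a ∈ (F j').B} :=
      Reg.of_finite ((Set.finite_singleton []).subset fun w hw => hw.1)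
    have h₂ : Reg {w | w ∈ (F j').N ∧ embed τ j' ((F j').phi w a) = u} := by
      by_cases hu : ∃ u', embed τ j' u' = u
      · obtain ⟨u', rfl⟩ := hu
        simpa only [(embed_injective j').eq_iff] using (hR j').reg_phi a u'
      · convert Reg.empty using 1
        exact Set.eq_empty_of_forall_notMem fun w hw => hu ⟨_, hw.2⟩
    convert (((hR j').reg_N.inter h₁).and_const (parentWord hF τ j' a = u)).union
      (h₂.inter h₁.compl) using 1
    ext w
    by_cases hw : w = [] ∧ a ∈ (F j').B
    · rw [Set.mem_ofPred_eq, flowRule_parent hF hw.1 hw.2]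
      exact ⟨fun h => Or.inl ⟨⟨h.1, hw⟩, h.2⟩,
        fun h => h.elim (fun h => ⟨h.1.1, h.2⟩) fun h => absurd hw h.2⟩
    · rw [Set.mem_ofPred_eq, flowRule_phi hF hw]
      exact ⟨fun h => Or.inr ⟨h, hw⟩, fun h => h.elim (fun h => absurd h.1.2 hw) fun h => h.1⟩
  · simp only [flowRule_of_ne hF h]
    exact (hR j').reg_N.and_const _

theorem piFlow_isRegular [Finite E] (hτ : τ.IsSpanningTree)
    (hF : ∀ j, (F j).IsFlow (edgeSub 𝒢 v₀ j)) : (piFlow hτ hF).IsRegular := by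
  have hN : Reg (piFlow hτ hF).N := by
    convert Reg.iUnion fun j => reg_lastPiece (τ := τ) hR j (hR j).reg_N using 1
    ext y
    simp only [Set.mem_iUnion]
    rfl
  refine ⟨hN, ?_⟩
  rintro (α | d) u
  · convert Reg.iUnion fun j' => (reg_lastPiece (τ := τ) hR j'
      ((reg_flowRule hR hF j' α u).and_const (vert Λ v₀ j' = vert Λ v₀ α.1))) using 1
    ext y
    simp only [Set.mem_iUnion]
    constructor
    · rintro ⟨⟨j, l, w, hl, hw, rfl⟩, hphi⟩
      -- The flow at `α` is governed by the last piece at the vertex of `α`; passing to that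
      -- representation leaves the word as it is.
      obtain ⟨j', l', w', hl', hw', hj', hval, hword⟩ := hl.moveTo hτ hF hw (vert Λ v₀ α.1)
      rw [piFlow_phi_inl hτ hF hl' hw' ((wordVal_seqWord _).trans hval.symm) hj'] at hphi
      exact ⟨j', l', w', hl', ⟨⟨hw', hphi⟩, hj'⟩, hword.symm⟩
    · rintro ⟨j', l, w, hl, ⟨⟨hw, hphi⟩, hj'⟩, rfl⟩
      refine ⟨⟨j', l, w, hl, hw, rfl⟩, ?_⟩
      rw [piFlow_phi_inl hτ hF hl hw (wordVal_seqWord _) hj', hphi]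
  · exact hN.and_const ([Sum.inr d] = u)

end Regularity

end GraphOfGroups

end GoG

/-! ### The main theorem -/

open GoG GoG.GraphOfGroups in
theorem theorem3p5 {V E : Type*} [Finite V] [Finite E] [Nonempty E]
    (Λ : GoG.EdgeGraph V E) (hΛ : Λ.toDirGraph.Connected)
    (𝒢 : GoG.GraphOfGroups Λ)
    (τ : Λ.toDirGraph.Subgraph) (hτ : τ.IsSpanningTree) :
    ((∀ d : E × Bool, GoG.AutostackableRespecting (𝒢.hom d).range) →
      GoG.Autostackable (𝒢.FundamentalGroup τ)) ∧
    ((∀ d : E × Bool, GoG.StackableRespecting (𝒢.hom d).range) →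
      GoG.Stackable (𝒢.FundamentalGroup τ)) := by
  -- The end of some edge serves as base vertex; the hypothesis at that edge, taken modulo the
  -- trivial subgroup, provides the flow data of the initial piece.
  have e₀ : E := Classical.arbitrary E
  constructor
  · intro h
    have key : ∀ j, ∃ (A : Type) (_ : Finite A)
        (F : FlowData (𝒢.vertexGroup (vert Λ (Λ.toDirGraph.tgt (e₀, true)) j)) A),
        F.IsFlow (edgeSub 𝒢 _ j) ∧ F.IsRegular := by
      rintro (_ | d)
      · obtain ⟨A, hA, S, T, Φ, K, hΦ, hreg, -⟩ := h (e₀, true)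
        obtain ⟨F, hF, hN, hphi⟩ := exists_isFlow_bot hΦ
        obtain ⟨h₁, h₂⟩ := regular_normalForms hΦ hreg
        exact ⟨A, hA, F, hF, by rwa [hN], by rw [hN, hphi]; exact h₂⟩
      · obtain ⟨A, hA, S, T, Φ, K, hΦ, hreg, hr⟩ := h d
        obtain ⟨F, hF, hF'⟩ := exists_isFlow_of_respects hΦ hr
        exact ⟨A, hA, F, hF, hF' hreg⟩
    choose A hA F hF hR using key
    exact (piFlow_isFlow hτ hF).autostackable (piFlow_isRegular hR hτ hF)
  · intro h
    have key : ∀ j, ∃ (A : Type) (_ : Finite A)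
        (F : FlowData (𝒢.vertexGroup (vert Λ (Λ.toDirGraph.tgt (e₀, true)) j)) A),
        F.IsFlow (edgeSub 𝒢 _ j) := by
      rintro (_ | d)
      · obtain ⟨A, hA, S, T, Φ, K, hΦ, -⟩ := h (e₀, true)
        obtain ⟨F, hF, -⟩ := exists_isFlow_bot hΦ
        exact ⟨A, hA, F, hF⟩
      · obtain ⟨A, hA, S, T, Φ, K, hΦ, hr⟩ := h d
        obtain ⟨F, hF, -⟩ := exists_isFlow_of_respects hΦ hr
        exact ⟨A, hA, F, hF⟩
    choose A hA F hF using key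
    exact (piFlow_isFlow hτ hF).stackable
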